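/- Let $m\ge 2$, let $0<\kappa<\tfrac12$, and let $\Omega\subset\mathbb R^2$ be a bounded open set containing the origin. Let $e_1=(1,0)$, $e_2=(0,1)$. For $\varepsilon>0$ let $$\Sigma_\varepsilon=\{\rho e_1:\ -\varepsilon\le\rho\le\varepsilon\},\qquad \Omega_\varepsilon=\{x\in\mathbb R^2:\ \operatorname{dist}(x,\Sigma_\varepsilon)<\varepsilon^2\},$$ and let $\gamma_\varepsilon=\kappa$ in $\Omega_\varepsilon$ and $\gamma_\varepsilon=1$ elsewhere. Let $H^m(\Omega)$ be the Sobolev space of functions whose weak derivatives of order at most $m$ are in $L^2(\Omega)$, $H^m_0(\Omega)$ the closure of $C_c^\infty(\Omega)$ in $H^m(\Omega)$, and $\nabla^m u$ the tensor of the weak derivatives $\partial^m u/\partial x_{j_1}\cdots\partial x_{j_m}$. For a multi-index $\boldsymbol i=(i_1,\dots,i_m)\in\{1,2\}^m$ put $V^{\boldsymbol i}(x)=\frac1{m!}x_{i_1}\cdots x_{i_m}$, and let $V^{\boldsymbol i}_\varepsilon\in H^m(\Omega)$ be the weak solution of $(\nabla\cdot)^m(\gamma_\varepsilon\nabla^mV^{\boldsymbol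 i}_\varepsilon)=0$ in $\Omega$ with the same boundary data as $V^{\boldsymbol i}$ up to order $m-1$, that is, $$V^{\boldsymbol i}_\varepsilon-V^{\boldsymbol i}\in H^m_0(\Omega),\qquad \int_\Omega\gamma_\varepsilon\,\nabla^mV^{\boldsymbol i}_\varepsilon\cdot\nabla^m\varphi\,dx=0\quad\text{for all }\varphi\in H^m_0(\Omega).$$ Given a sequence $\varepsilon_n>0$ with $\varepsilon_n\to0$, a tensor $\mathbb M=(\mathbb M_{\boldsymbol i\boldsymbol j})$ of order $2m$ is called a polarization tensor along $(\varepsilon_n)$ if for all multi-indices $\boldsymbol i,\boldsymbol j$ $$\lim_{n\to\infty}\frac1{|\Omega_{\varepsilon_n}|}\int_{\Omega}\chi_{\Omega_{\varepsilon_n}}\frac{\partial^mV^{\boldsymbol i}_{\varepsilon_n}}{\partial x_{j_1}\cdots\partial x_{j_m}}\,\phi\,dx=\mathbb M_{\boldsymbol i\boldsymbol j}\,\phi(0)\qquad\text{for all }\phi\in C^0(\overline\Omega).$$ Then: (a) every sequence $\varepsilon_n>0$ with $\varepsilon_n\to0$ has a subsequence along which there is a polarization tensor $\mathbb M$; (b)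 for every sequence $\varepsilon_n>0$ with $\varepsilon_n\to0$ and every polarization tensor $\mathbb M$ along it, $$\mathbb M E^{m+1}\cdot E^{m+1}=\sum_{\boldsymbol i,\boldsymbol j}E^{m+1}_{\boldsymbol i}\,\mathbb M_{\boldsymbol i\boldsymbol j}\,E^{m+1}_{\boldsymbol j}=\frac1\kappa,\qquad\text{where } E^{m+1}=\underbrace{e_2\otimes\cdots\otimes e_2}_{m}.$$ -/

import Mathlib

open MeasureTheory Filter Topology
open scoped ContDiff Matrix

/-- The Euclidean plane. -/
abbrev Plane : Type := EuclideanSpace ℝ (Fin 2)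

/-- The unit vector `e₁ = (1, 0)`. -/
noncomputable def e₁ : Plane := EuclideanSpace.single 0 1

/-- The unit vector `e₂ = (0, 1)`. -/
noncomputable def e₂ : Plane := EuclideanSpace.single 1 1

/-! ### Tensors, as hypermatrices -/

/-- Multi-indices `(i₁, …, iₘ)` with every `iₖ` one of the two coordinates. -/
abbrev MIdx (m : ℕ) : Type := Fin m → Fin 2

/-- Tensors of order `m` over `ℝ²`. -/
abbrev Tensor (m : ℕ) : Type := MIdx m → ℝ

/-- Tensors of order `2m` over `ℝ²`, with entries `M_{ij}` indexed by two multi-indices of length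
`m`.  `M *ᵥ A` is the tensor `∑ⱼ M_{ij} Aⱼ` and `A ⬝ᵥ B` is the scalar product of two tensors. -/
abbrev Tensor2 (m : ℕ) : Type := Matrix (MIdx m) (MIdx m) ℝ

/-- The `m`-fold tensor power `v ⊗ ⋯ ⊗ v`. -/
noncomputable def tensorPower (m : ℕ) (v : Plane) : Tensor m := fun i => ∏ k, v (i k)

/-! ### Sobolev spaces, through weak derivatives -/

/-- Test functions in `C_c^∞(Ω)`. -/
def IsTest (Ω : Set Plane) (φ : Plane → ℝ) : Prop :=
  ContDiff ℝ ∞ φ ∧ HasCompactSupport φ ∧ tsupport φ ⊆ Ω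

/-- The classical partial derivative `∂ᵏφ / ∂x_{i₁} ⋯ ∂x_{iₖ}`. -/
noncomputable def classicalPartial {k : ℕ} (i : MIdx k) (φ : Plane → ℝ) (x : Plane) : ℝ :=
  iteratedFDeriv ℝ k φ x (fun l => EuclideanSpace.single (i l) (1 : ℝ))

/-- `g` is the weak derivative `∂ᵏu / ∂x_{i₁} ⋯ ∂x_{iₖ}` of `u` in `Ω`. -/
def IsWeakPartial (Ω : Set Plane) {k : ℕ} (i : MIdx k) (u g : Plane → ℝ) : Prop :=
  LocallyIntegrableOn u Ω ∧ LocallyIntegrableOn g Ω ∧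
    ∀ φ, IsTest Ω φ →
      ∫ x in Ω, u x * classicalPartial i φ x = (-1) ^ k * ∫ x in Ω, g x * φ x

open Classical in
/-- The weak derivative `∂ᵏu / ∂x_{i₁} ⋯ ∂x_{iₖ}` in `Ω`; it is determined almost everywhere in
`Ω` when it exists, and is set to be `0` otherwise. -/
noncomputable def weakPartial (Ω : Set Plane) {k : ℕ} (i : MIdx k) (u : Plane → ℝ) : Plane → ℝ :=
  if h : ∃ g, IsWeakPartial Ω i u g then h.choose else 0

/-- The weak tensor `∇ᵏu` of the derivatives of order `k`. -/
noncomputable def weakGrad (Ω : Set Plane) (k : ℕ) (u : Plane → ℝ) (x : Plane) : Tensor k :=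
  fun i => weakPartial Ω i u x

/-- `u ∈ Hᵐ(Ω)`: all weak derivatives of order at most `m` (order `0` is `u` itself) exist and are
square integrable. -/
def MemH (m : ℕ) (Ω : Set Plane) (u : Plane → ℝ) : Prop :=
  ∀ k ≤ m, ∀ i : MIdx k,
    (∃ g, IsWeakPartial Ω i u g) ∧ MemLp (weakPartial Ω i u) 2 (volume.restrict Ω)

/-- The squared norm `‖u‖²_{Hᵐ(Ω)} = ∑_{k ≤ m} ∫_Ω |∇ᵏu|²`. -/
noncomputable def normSqH (m : ℕ) (Ω : Set Plane) (u : Plane → ℝ) : ℝ :=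
  ∑ k ∈ Finset.range (m + 1), ∫ x in Ω, weakGrad Ω k u x ⬝ᵥ weakGrad Ω k u x

/-- `u ∈ H₀ᵐ(Ω)`: the closure of `C_c^∞(Ω)` in `Hᵐ(Ω)`. -/
def MemH0 (m : ℕ) (Ω : Set Plane) (u : Plane → ℝ) : Prop :=
  MemH m Ω u ∧ ∀ δ > 0, ∃ φ, IsTest Ω φ ∧ normSqH m Ω (u - φ) < δ

/-! ### The thin strip and the polarization tensor -/

/-- The segment `Σ_ε(y, τ) = {y + ρ τ : -ε ≤ ρ ≤ ε}`. -/
def segmentSet (y τ : Plane) (ε : ℝ) : Set Plane :=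
  {x | ∃ ρ : ℝ, -ε ≤ ρ ∧ ρ ≤ ε ∧ x = y + ρ • τ}

/-- The thin strip `Ω_ε(y, τ)` of the points at distance less than `ε²` from `Σ_ε(y, τ)`. -/
def strip (y τ : Plane) (ε : ℝ) : Set Plane :=
  {x | Metric.infDist x (segmentSet y τ ε) < ε ^ 2}

open Classical in
/-- The coefficient `γ_ε`, equal to `κ` in the strip and to `1` elsewhere. -/
noncomputable def gammaCoeff (κ : ℝ) (y τ : Plane) (ε : ℝ) (x : Plane) : ℝ :=
  if x ∈ strip y τ ε then κ else 1

/-- The polynomial `Vⁱ(x) = (1 / m!) x_{i₁} ⋯ x_{iₘ}`. -/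
noncomputable def potential {m : ℕ} (i : MIdx m) (x : Plane) : ℝ :=
  (1 / (m.factorial : ℝ)) * ∏ k, x (i k)

/-- `v` is the (weak) solution `V_εⁱ` of `(∇·)ᵐ (γ_ε ∇ᵐ v) = 0` in `Ω` that has the same boundary
values as `Vⁱ` together with the normal derivatives up to order `m - 1`. -/
def IsPerturbedPotential {m : ℕ} (Ω : Set Plane) (κ : ℝ) (y τ : Plane) (ε : ℝ) (i : MIdx m)
    (v : Plane → ℝ) : Prop :=
  MemH m Ω v ∧ MemH0 m Ω (v - potential i) ∧
    ∀ φ, MemH0 m Ω φ →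
      ∫ x in Ω, gammaCoeff κ y τ ε x * (weakGrad Ω m v x ⬝ᵥ weakGrad Ω m φ x) = 0

/-- `M` is the polarization tensor of order `2m` obtained along the sequence of parameters `ε`: for
all multi-indices `i`, `j` the measures `|Ω_ε|⁻¹ χ_{Ω_ε} (∂ᵐV_εⁱ / ∂x_{j₁} ⋯ ∂x_{jₘ}) dx` converge
weakly-* in the dual of `C⁰(closure Ω)` to `M_{ij} δ_y`. -/
def IsPolarizationTensor {m : ℕ} (Ω : Set Plane) (κ : ℝ) (y τ : Plane) (ε : ℕ → ℝ)
    (M : Tensor2 m) : Prop :=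
  ∃ V : ℕ → MIdx m → Plane → ℝ,
    (∀ n i, IsPerturbedPotential Ω κ y τ (ε n) i (V n i)) ∧
    ∀ i j : MIdx m, ∀ φ : Plane → ℝ, ContinuousOn φ (closure Ω) →
      Tendsto
        (fun n => (volume.real (strip y τ (ε n)))⁻¹ *
          ∫ x in Ω, (strip y τ (ε n)).indicator (weakPartial Ω j (V n i)) x * φ x)
        atTop (𝓝 (M i j * φ y))

/-!
The perturbed potential `v = V_εⁱ` is compared with the tensor field `γ⁻¹ ∇ᵐVⁱ`.  Since `∇ᵐVⁱ` is a
constant tensor (`classicalPartial_potential`), the flux `γ (γ⁻¹ ∇ᵐVⁱ) = ∇ᵐVⁱ` is orthogonal to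
`∇ᵐφ` for all `φ ∈ H₀ᵐ(Ω)`, and so is `γ ∇ᵐv`.  Testing the difference `R = ∇ᵐv - γ⁻¹ ∇ᵐVⁱ` with
`v - Vⁱ - ψ` shows, for every test function `ψ`, that
`κ ‖R‖² ≤ ‖∇ᵐψ - (γ⁻¹ - 1) ∇ᵐVⁱ‖²` in `L²(Ω)`: this is `IsPerturbedPotential.quasi_optimal`.

With `ψ = 0` the right-hand side is `O(|Ω_ε|)`, because `γ⁻¹ - 1` lives on the strip.  The averages
of `∂ᵐv` over the strip are therefore bounded, converge along a subsequence, and, as the strip shrinks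
to the origin, determine the weak-* limit (`exists_subseq_isPolarizationTensor`).  The perturbed
potentials themselves exist by orthogonal projection in a weighted `L²` space together with the
Poincaré inequality (`exists_isPerturbedPotential`).

For `Vⁱ = x₂ᵐ / m!` the field `(γ⁻¹ - 1) ∇ᵐVⁱ` is, up to `o(|Ω_ε|)` in the square of the
`L²`-norm, the gradient of a test function (`eventually_exists_trial`).  One takes
`ψ = (κ⁻¹ - 1) εᵐ A(x₁/ε) B(x₂/ε)` with a cut-off `A` equal to one on a neighbourhood of `[-1, 1]`
and a profile `B` whose derivative of order `m` is a smooth version of the indicator function of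
`(-ε, ε)`.  All lower derivatives of `B` are `O(ε)`, so that outside a thin frame around the strip the
square of the error is `O(ε²)` on an area `O(ε²)`, which is negligible against `|Ω_ε| ≥ 4ε³`.  The
frame has an area of at most a small multiple of `ε³`.  Hence `∂₂ᵐv` is `κ⁻¹` in the strip, up to
an error that vanishes on average (`IsPolarizationTensor.eq_of_trial`).
-/

/-! ### Classical partial derivatives -/

theorem classicalPartial_zero (i : MIdx 0) (u : Plane → ℝ) : classicalPartial i u = u := by
  funext x
  simp [classicalPartial]

/-- The outermost derivative of an iterated partial derivative is the one of the first index. -/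
theorem classicalPartial_succ {k : ℕ} (i : MIdx (k + 1)) {u : Plane → ℝ} (hu : ContDiff ℝ ∞ u) :
    classicalPartial i u =
      fun x => fderiv ℝ (classicalPartial (Fin.tail i) u) x (EuclideanSpace.single (i 0) 1) := by
  funext x
  have hd : DifferentiableAt ℝ (iteratedFDeriv ℝ k u) x :=
    (hu.differentiable_iteratedFDeriv (by exact_mod_cast WithTop.coe_lt_top _)) x
  exact hd.iteratedFDeriv_succ_apply_left'

theorem contDiff_classicalPartial {k : ℕ} (i : MIdx k) {u : Plane → ℝ} (hu : ContDiff ℝ ∞ u) :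
    ContDiff ℝ ∞ (classicalPartial i u) := by
  have h : ContDiff ℝ ∞ (iteratedFDeriv ℝ k u) :=
    hu.iteratedFDeriv_right (by exact_mod_cast le_top)
  exact (ContinuousMultilinearMap.apply ℝ (fun _ : Fin k => Plane) ℝ
    (fun l => EuclideanSpace.single (i l) (1 : ℝ))).contDiff.comp h

theorem tsupport_classicalPartial_subset {k : ℕ} (i : MIdx k) (u : Plane → ℝ) :
    tsupport (classicalPartial i u) ⊆ tsupport u := by
  refine (closure_mono fun x hx => ?_).trans (tsupport_iteratedFDeriv_subset (𝕜 := ℝ) (f := u) k)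
  intro h
  apply hx
  simp [classicalPartial, h]

theorem IsTest.classicalPartial {Ω : Set Plane} {k : ℕ} (i : MIdx k) {φ : Plane → ℝ}
    (hφ : IsTest Ω φ) : IsTest Ω (classicalPartial i φ) :=
  ⟨contDiff_classicalPartial i hφ.1,
    hφ.2.1.of_isClosed_subset (isClosed_tsupport _) (tsupport_classicalPartial_subset i φ),
    (tsupport_classicalPartial_subset i φ).trans hφ.2.2⟩

theorem contDiff_fderiv_single {u : Plane → ℝ} (hu : ContDiff ℝ ∞ u) (a : Fin 2) :
    ContDiff ℝ ∞ (fun x => fderiv ℝ u x (EuclideanSpace.single a 1)) :=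
  (hu.fderiv_right (m := ∞) (by simp)).clm_apply contDiff_const

theorem classicalPartial_sub {k : ℕ} (i : MIdx k) {u v : Plane → ℝ} (hu : ContDiff ℝ ∞ u)
    (hv : ContDiff ℝ ∞ v) :
    classicalPartial i (u - v) = classicalPartial i u - classicalPartial i v := by
  funext x
  simp only [classicalPartial, Pi.sub_apply]
  rw [iteratedFDeriv_sub_apply (hu.of_le (by exact_mod_cast le_top)).contDiffAt
    (hv.of_le (by exact_mod_cast le_top)).contDiffAt]
  rfl

theorem classicalPartial_add {k : ℕ} (i : MIdx k) {u v : Plane → ℝ} (hu : ContDiff ℝ ∞ u)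
    (hv : ContDiff ℝ ∞ v) :
    classicalPartial i (u + v) = classicalPartial i u + classicalPartial i v := by
  funext x
  simp only [classicalPartial, Pi.add_apply]
  rw [iteratedFDeriv_add_apply (hu.of_le (by exact_mod_cast le_top)).contDiffAt
    (hv.of_le (by exact_mod_cast le_top)).contDiffAt]
  rfl

theorem classicalPartial_const_smul {k : ℕ} (i : MIdx k) (c : ℝ) {u : Plane → ℝ}
    (hu : ContDiff ℝ ∞ u) : classicalPartial i (c • u) = c • classicalPartial i u := by
  funext x
  simp only [classicalPartial, Pi.smul_apply]
  rw [iteratedFDeriv_const_smul_apply (hu.of_le (by exact_mod_cast le_top)).contDiffAt]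
  rfl

/-- Partial derivatives of a smooth function commute. -/
theorem classicalPartial_fderiv_single {k : ℕ} (i : MIdx k) {u : Plane → ℝ}
    (hu : ContDiff ℝ ∞ u) (a : Fin 2) :
    classicalPartial i (fun x => fderiv ℝ u x (EuclideanSpace.single a 1)) =
      fun x => fderiv ℝ (classicalPartial i u) x (EuclideanSpace.single a 1) := by
  induction k with
  | zero => simp only [classicalPartial_zero]
  | succ k ih =>
    rw [classicalPartial_succ i (contDiff_fderiv_single hu a), ih, classicalPartial_succ i hu]
    funext x
    have hw := contDiff_classicalPartial (Fin.tail i) hu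
    have hd : DifferentiableAt ℝ (fderiv ℝ (classicalPartial (Fin.tail i) u)) x :=
      ((hw.fderiv_right (m := ∞) (by simp)).differentiable (by simp)) x
    have hs : IsSymmSndFDerivAt ℝ (classicalPartial (Fin.tail i) u) x :=
      hw.contDiffAt.isSymmSndFDerivAt (by
        rw [minSmoothness_of_isRCLikeNormedField]; exact ENat.LEInfty.out)
    have key : ∀ b c : Plane, fderiv ℝ (fun y => fderiv ℝ (classicalPartial (Fin.tail i) u) y b) x c
        = fderiv ℝ (fderiv ℝ (classicalPartial (Fin.tail i) u)) x c b := by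
      intro b c
      rw [fderiv_clm_apply hd (differentiableAt_const b)]
      simp
    rw [key, key]
    exact hs _ _

theorem IsTest.continuous {Ω : Set Plane} {φ : Plane → ℝ} (h : IsTest Ω φ) : Continuous φ :=
  h.1.continuous

theorem IsTest.integrable_mul {Ω : Set Plane} {φ : Plane → ℝ} (h : IsTest Ω φ) {u : Plane → ℝ}
    (hu : Continuous u) : Integrable (fun x => u x * φ x) :=
  (hu.mul h.continuous).integrable_of_hasCompactSupport h.2.1.mul_left

theorem IsTest.eq_zero {Ω : Set Plane} {φ : Plane → ℝ} (h : IsTest Ω φ) {x : Plane}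
    (hx : x ∉ Ω) : φ x = 0 :=
  image_eq_zero_of_notMem_tsupport fun h' => hx (h.2.2 h')

theorem IsTest.setIntegral_eq {Ω : Set Plane} {φ : Plane → ℝ} (h : IsTest Ω φ) (u : Plane → ℝ) :
    ∫ x in Ω, u x * φ x = ∫ x, u x * φ x :=
  setIntegral_eq_integral_of_forall_compl_eq_zero fun x hx => by rw [h.eq_zero hx, mul_zero]

/-- Integration by parts against a test function. -/
theorem integral_mul_classicalPartial {Ω : Set Plane} {k : ℕ} (i : MIdx k) {u φ : Plane → ℝ}
    (hu : ContDiff ℝ ∞ u) (hφ : IsTest Ω φ) :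
    ∫ x in Ω, u x * classicalPartial i φ x = (-1) ^ k * ∫ x in Ω, classicalPartial i u x * φ x := by
  induction k generalizing u with
  | zero => simp only [classicalPartial_zero]; simp
  | succ k ih =>
    have hψ := hφ.classicalPartial (Fin.tail i)
    have hu' := contDiff_fderiv_single hu (i 0)
    have h1 : ∫ x, u x * classicalPartial i φ x
        = - ∫ x, fderiv ℝ u x (EuclideanSpace.single (i 0) 1) *
            classicalPartial (Fin.tail i) φ x := by
      have hi := hφ.classicalPartial i
      rw [classicalPartial_succ i hφ.1] at hi ⊢
      exact integral_mul_fderiv_eq_neg_fderiv_mul_of_integrable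
        (hψ.integrable_mul hu'.continuous) (hi.integrable_mul hu.continuous)
        (hψ.integrable_mul hu.continuous)
        (fun x _ => hu.differentiable (by simp) x) (fun x _ => hψ.1.differentiable (by simp) x)
    have h2 := ih (Fin.tail i) hu'
    rw [(hφ.classicalPartial i).setIntegral_eq, h1, ← hψ.setIntegral_eq, h2,
      classicalPartial_fderiv_single _ hu, ← classicalPartial_succ i hu, pow_succ]
    ring

/-! ### Weak partial derivatives -/

theorem isWeakPartial_classicalPartial (Ω : Set Plane) {k : ℕ} (i : MIdx k)
    {u : Plane → ℝ} (hu : ContDiff ℝ ∞ u) : IsWeakPartial Ω i u (classicalPartial i u) :=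
  ⟨(hu.continuous.locallyIntegrable).locallyIntegrableOn Ω,
    ((contDiff_classicalPartial i hu).continuous.locallyIntegrable).locallyIntegrableOn Ω,
    fun _ hφ => integral_mul_classicalPartial i hu hφ⟩

theorem MeasureTheory.LocallyIntegrableOn.integrable_mul_isTest {Ω : Set Plane} {g φ : Plane → ℝ}
    (hg : LocallyIntegrableOn g Ω) (hφ : IsTest Ω φ) :
    Integrable (fun x => g x * φ x) (volume.restrict Ω) := by
  have h1 : IntegrableOn g (tsupport φ) :=
    hg.integrableOn_compact_subset hφ.2.2 hφ.2.1
  have h2 : IntegrableOn (fun x => g x * φ x) (tsupport φ) :=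
    h1.mul_continuousOn hφ.continuous.continuousOn hφ.2.1
  have h3 : Integrable (fun x => g x * φ x) volume := by
    rw [← integrableOn_univ]
    refine h2.of_forall_sdiff_eq_zero MeasurableSet.univ fun x hx => ?_
    rw [image_eq_zero_of_notMem_tsupport hx.2, mul_zero]
  exact h3.restrict

theorem IsWeakPartial.ae_eq {Ω : Set Plane} (hΩ : IsOpen Ω) {k : ℕ} {i : MIdx k}
    {u g h : Plane → ℝ} (hg : IsWeakPartial Ω i u g) (hh : IsWeakPartial Ω i u h) :
    g =ᵐ[volume.restrict Ω] h := by
  have key : ∀ᵐ x ∂(volume : Measure Plane), x ∈ Ω → (g - h) x = 0 := by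
    refine hΩ.ae_eq_zero_of_integral_contDiff_smul_eq_zero (hg.2.1.sub hh.2.1)
      fun φ h1 h2 h3 => ?_
    have hφ : IsTest Ω φ := ⟨h1, h2, h3⟩
    have e : ∫ x in Ω, g x * φ x = ∫ x in Ω, h x * φ x := by
      have := (hg.2.2 φ hφ).symm.trans (hh.2.2 φ hφ)
      exact mul_left_cancel₀ (pow_ne_zero k (by norm_num)) this
    have := hφ.setIntegral_eq (g - h)
    simp only [smul_eq_mul, mul_comm (φ _)]
    rw [← this]
    simp only [Pi.sub_apply, sub_mul]
    rw [integral_sub (hg.2.1.integrable_mul_isTest hφ) (hh.2.1.integrable_mul_isTest hφ), e,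
      sub_self]
  rw [Filter.EventuallyEq, ae_restrict_iff' hΩ.measurableSet]
  filter_upwards [key] with x hx hxΩ
  exact sub_eq_zero.1 (hx hxΩ)

theorem IsWeakPartial.sub {Ω : Set Plane} {k : ℕ} {i : MIdx k}
    {u v g h : Plane → ℝ} (hg : IsWeakPartial Ω i u g) (hh : IsWeakPartial Ω i v h) :
    IsWeakPartial Ω i (u - v) (g - h) := by
  refine ⟨hg.1.sub hh.1, hg.2.1.sub hh.2.1, fun φ hφ => ?_⟩
  simp only [Pi.sub_apply, sub_mul]
  rw [integral_sub (hg.1.integrable_mul_isTest (hφ.classicalPartial i))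
    (hh.1.integrable_mul_isTest (hφ.classicalPartial i)),
    integral_sub (hg.2.1.integrable_mul_isTest hφ) (hh.2.1.integrable_mul_isTest hφ),
    hg.2.2 φ hφ, hh.2.2 φ hφ, mul_sub]

theorem IsWeakPartial.add {Ω : Set Plane} {k : ℕ} {i : MIdx k}
    {u v g h : Plane → ℝ} (hg : IsWeakPartial Ω i u g) (hh : IsWeakPartial Ω i v h) :
    IsWeakPartial Ω i (u + v) (g + h) := by
  refine ⟨hg.1.add hh.1, hg.2.1.add hh.2.1, fun φ hφ => ?_⟩
  simp only [Pi.add_apply, add_mul]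
  rw [integral_add (hg.1.integrable_mul_isTest (hφ.classicalPartial i))
    (hh.1.integrable_mul_isTest (hφ.classicalPartial i)),
    integral_add (hg.2.1.integrable_mul_isTest hφ) (hh.2.1.integrable_mul_isTest hφ),
    hg.2.2 φ hφ, hh.2.2 φ hφ, mul_add]

theorem isWeakPartial_weakPartial {Ω : Set Plane} {k : ℕ} {i : MIdx k}
    {u : Plane → ℝ} (h : ∃ g, IsWeakPartial Ω i u g) :
    IsWeakPartial Ω i u (weakPartial Ω i u) := by
  rw [weakPartial, dif_pos h]
  exact h.choose_spec

theorem IsWeakPartial.weakPartial_ae_eq {Ω : Set Plane} (hΩ : IsOpen Ω) {k : ℕ} {i : MIdx k}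
    {u g : Plane → ℝ} (h : IsWeakPartial Ω i u g) :
    weakPartial Ω i u =ᵐ[volume.restrict Ω] g :=
  (isWeakPartial_weakPartial ⟨g, h⟩).ae_eq hΩ h

/-- It is enough to exhibit square integrable weak derivatives. -/
theorem memH_of_isWeakPartial {Ω : Set Plane} (hΩ : IsOpen Ω) {m : ℕ} {u : Plane → ℝ}
    (h : ∀ k ≤ m, ∀ i : MIdx k, ∃ g, IsWeakPartial Ω i u g ∧ MemLp g 2 (volume.restrict Ω)) :
    MemH m Ω u := by
  intro k hk i
  obtain ⟨g, hg, hg2⟩ := h k hk i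
  exact ⟨⟨g, hg⟩, (memLp_congr_ae (hg.weakPartial_ae_eq hΩ)).2 hg2⟩

theorem MemH.isWeakPartial {Ω : Set Plane} {m k : ℕ} {u : Plane → ℝ} (h : MemH m Ω u)
    (hk : k ≤ m) (i : MIdx k) : IsWeakPartial Ω i u (weakPartial Ω i u) :=
  isWeakPartial_weakPartial (h k hk i).1

theorem MemH.sub {Ω : Set Plane} (hΩ : IsOpen Ω) {m : ℕ} {u v : Plane → ℝ} (hu : MemH m Ω u)
    (hv : MemH m Ω v) : MemH m Ω (u - v) :=
  memH_of_isWeakPartial hΩ fun k hk i =>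
    ⟨_, (hu.isWeakPartial hk i).sub (hv.isWeakPartial hk i), (hu k hk i).2.sub (hv k hk i).2⟩

theorem MemH.add {Ω : Set Plane} (hΩ : IsOpen Ω) {m : ℕ} {u v : Plane → ℝ} (hu : MemH m Ω u)
    (hv : MemH m Ω v) : MemH m Ω (u + v) :=
  memH_of_isWeakPartial hΩ fun k hk i =>
    ⟨_, (hu.isWeakPartial hk i).add (hv.isWeakPartial hk i), (hu k hk i).2.add (hv k hk i).2⟩

theorem MemH.weakPartial_sub_ae_eq {Ω : Set Plane} (hΩ : IsOpen Ω) {m k : ℕ} {u v : Plane → ℝ}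
    (hu : MemH m Ω u) (hv : MemH m Ω v) (hk : k ≤ m) (i : MIdx k) :
    weakPartial Ω i (u - v) =ᵐ[volume.restrict Ω] weakPartial Ω i u - weakPartial Ω i v :=
  ((hu.isWeakPartial hk i).sub (hv.isWeakPartial hk i)).weakPartial_ae_eq hΩ

/-- A continuous function is square integrable on a bounded set. -/
theorem Continuous.memLp_two_restrict {Ω : Set Plane} (hΩb : Bornology.IsBounded Ω)
    {f : Plane → ℝ} (hf : Continuous f) : MemLp f 2 (volume.restrict Ω) := by
  have hc : IsCompact (closure Ω) := hΩb.isCompact_closure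
  obtain ⟨C, hC⟩ := hc.exists_bound_of_continuousOn hf.continuousOn
  have : IsFiniteMeasure (volume.restrict (closure Ω)) :=
    ⟨by simpa using hc.measure_lt_top⟩
  have h : MemLp f 2 (volume.restrict (closure Ω)) := by
    refine MemLp.of_bound hf.aestronglyMeasurable C ?_
    exact (ae_restrict_iff' isClosed_closure.measurableSet).2 (Eventually.of_forall hC)
  exact h.mono_measure (Measure.restrict_mono subset_closure le_rfl)

theorem memH_of_contDiff {Ω : Set Plane} (hΩ : IsOpen Ω) (hΩb : Bornology.IsBounded Ω) (m : ℕ)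
    {u : Plane → ℝ} (hu : ContDiff ℝ ∞ u) : MemH m Ω u :=
  memH_of_isWeakPartial hΩ fun _ _ i => ⟨_, isWeakPartial_classicalPartial Ω i hu,
    (contDiff_classicalPartial i hu).continuous.memLp_two_restrict hΩb⟩

theorem weakPartial_ae_eq_classicalPartial {Ω : Set Plane} (hΩ : IsOpen Ω) {k : ℕ} (i : MIdx k)
    {u : Plane → ℝ} (hu : ContDiff ℝ ∞ u) :
    weakPartial Ω i u =ᵐ[volume.restrict Ω] classicalPartial i u :=
  (isWeakPartial_classicalPartial Ω i hu).weakPartial_ae_eq hΩ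

theorem IsTest.sub {Ω : Set Plane} {φ ψ : Plane → ℝ} (hφ : IsTest Ω φ) (hψ : IsTest Ω ψ) :
    IsTest Ω (φ - ψ) :=
  ⟨hφ.1.sub hψ.1, hφ.2.1.sub hψ.2.1,
    (tsupport_sub φ ψ).trans (Set.union_subset hφ.2.2 hψ.2.2)⟩

theorem IsTest.add {Ω : Set Plane} {φ ψ : Plane → ℝ} (hφ : IsTest Ω φ) (hψ : IsTest Ω ψ) :
    IsTest Ω (φ + ψ) :=
  ⟨hφ.1.add hψ.1, hφ.2.1.add hψ.2.1,
    (tsupport_add φ ψ).trans (Set.union_subset hφ.2.2 hψ.2.2)⟩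

theorem isTest_zero (Ω : Set Plane) : IsTest Ω 0 :=
  ⟨contDiff_const, HasCompactSupport.zero, by simp⟩

theorem IsTest.const_smul {Ω : Set Plane} {φ : Plane → ℝ} (c : ℝ) (hφ : IsTest Ω φ) :
    IsTest Ω (c • φ) :=
  ⟨contDiff_const.smul hφ.1, hφ.2.1.smul_left (f := fun _ => c),
    (tsupport_smul_subset_right (fun _ => c) φ).trans hφ.2.2⟩

theorem MemH0.sub_isTest {Ω : Set Plane} (hΩ : IsOpen Ω) (hΩb : Bornology.IsBounded Ω) {m : ℕ}
    {u φ : Plane → ℝ} (hu : MemH0 m Ω u) (hφ : IsTest Ω φ) : MemH0 m Ω (u - φ) := by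
  refine ⟨hu.1.sub hΩ (memH_of_contDiff hΩ hΩb m hφ.1), fun δ hδ => ?_⟩
  obtain ⟨ψ, hψ, h⟩ := hu.2 δ hδ
  exact ⟨ψ - φ, hψ.sub hφ, by rwa [sub_sub_sub_cancel_right]⟩

/-! ### Partial derivatives of products of functions of one variable -/

/-- The number of entries of the multi-index `i` that are equal to `a`. -/
def idxCount (a : Fin 2) {k : ℕ} (i : MIdx k) : ℕ := ∑ l, if i l = a then 1 else 0

theorem idxCount_succ (a : Fin 2) {k : ℕ} (i : MIdx (k + 1)) :
    idxCount a i = (if i 0 = a then 1 else 0) + idxCount a (Fin.tail i) := by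
  simp only [idxCount, Fin.sum_univ_succ]
  rfl

theorem idxCount_zero_add_one {k : ℕ} (i : MIdx k) : idxCount 0 i + idxCount 1 i = k := by
  rw [idxCount, idxCount, ← Finset.sum_add_distrib]
  have : ∀ l : Fin k, ((if i l = 0 then 1 else 0) + if i l = 1 then 1 else 0) = 1 := by
    intro l
    have := Fin.exists_fin_two.1 ⟨i l, rfl⟩
    rcases this with h | h <;> simp [h]
  simp [this]

theorem contDiff_coord_mul {a b : ℝ → ℝ} (ha : ContDiff ℝ ∞ a) (hb : ContDiff ℝ ∞ b) :
    ContDiff ℝ ∞ (fun x : Plane => a (x 0) * b (x 1)) := by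
  have h : ∀ c : Fin 2, ContDiff ℝ ∞ (fun x : Plane => x c) := fun c =>
    (EuclideanSpace.proj (𝕜 := ℝ) c).contDiff
  exact (ha.comp (h 0)).mul (hb.comp (h 1))

theorem fderiv_coord_mul_single {a b : ℝ → ℝ} (ha : Differentiable ℝ a) (hb : Differentiable ℝ b)
    (x : Plane) (c : Fin 2) :
    fderiv ℝ (fun x : Plane => a (x 0) * b (x 1)) x (EuclideanSpace.single c 1) =
      if c = 0 then deriv a (x 0) * b (x 1) else a (x 0) * deriv b (x 1) := by
  have hp : ∀ c : Fin 2, HasFDerivAt (fun x : Plane => x c)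
      (EuclideanSpace.proj (𝕜 := ℝ) c) x := fun c =>
    (EuclideanSpace.proj (𝕜 := ℝ) c).hasFDerivAt
  have h1 := (ha (x 0)).hasDerivAt.comp_hasFDerivAt x (hp 0)
  have h2 := (hb (x 1)).hasDerivAt.comp_hasFDerivAt x (hp 1)
  have h3 : HasFDerivAt (fun x : Plane => a (x 0) * b (x 1)) _ x := h1.mul h2
  rw [h3.fderiv]
  have := Fin.exists_fin_two.1 ⟨c, rfl⟩
  rcases this with h | h <;> simp [h, mul_comm]

theorem classicalPartial_coord_mul {k : ℕ} (i : MIdx k) {a b : ℝ → ℝ} (ha : ContDiff ℝ ∞ a)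
    (hb : ContDiff ℝ ∞ b) :
    classicalPartial i (fun x : Plane => a (x 0) * b (x 1)) =
      fun x => iteratedDeriv (idxCount 0 i) a (x 0) * iteratedDeriv (idxCount 1 i) b (x 1) := by
  induction k with
  | zero => simp [classicalPartial_zero, idxCount]
  | succ k ih =>
    rw [classicalPartial_succ i (contDiff_coord_mul ha hb), ih]
    funext x
    have hd : ∀ (n : ℕ) {a : ℝ → ℝ}, ContDiff ℝ ∞ a → Differentiable ℝ (iteratedDeriv n a) :=
      fun n a ha => ha.differentiable_iteratedDeriv n (by exact_mod_cast WithTop.coe_lt_top _)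
    rw [fderiv_coord_mul_single (hd _ ha) (hd _ hb), idxCount_succ, idxCount_succ]
    have := Fin.exists_fin_two.1 ⟨i 0, rfl⟩
    rcases this with h | h <;> simp [h, add_comm 1, iteratedDeriv_succ]

/-! ### The potentials -/

/-- The constant value of `∂ᵐVⁱ / ∂x_{j₁} ⋯ ∂x_{jₘ}`. -/
noncomputable def potentialCoeff {m : ℕ} (i j : MIdx m) : ℝ :=
  if idxCount 0 j = idxCount 0 i then
    (idxCount 0 i).factorial * (idxCount 1 i).factorial / m.factorial else 0

theorem potential_eq {m : ℕ} (i : MIdx m) :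
    potential i = (1 / (m.factorial : ℝ)) • fun x : Plane =>
      x 0 ^ idxCount 0 i * x 1 ^ idxCount 1 i := by
  funext x
  simp only [potential, Pi.smul_apply, smul_eq_mul, idxCount, ← Finset.prod_pow_eq_pow_sum]
  congr 1
  rw [← Finset.prod_mul_distrib]
  refine Finset.prod_congr rfl fun l _ => ?_
  have := Fin.exists_fin_two.1 ⟨i l, rfl⟩
  rcases this with h | h <;> simp [h]

theorem contDiff_potential {m : ℕ} (i : MIdx m) : ContDiff ℝ ∞ (potential i) := by
  rw [potential_eq]
  exact contDiff_const.smul (contDiff_coord_mul (contDiff_id.pow _) (contDiff_id.pow _))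

theorem classicalPartial_potential {m : ℕ} (i j : MIdx m) :
    classicalPartial j (potential i) = fun _ => potentialCoeff i j := by
  have hc := contDiff_coord_mul (a := fun t => t ^ idxCount 0 i) (b := fun t => t ^ idxCount 1 i)
    (contDiff_id.pow _) (contDiff_id.pow _)
  rw [potential_eq, classicalPartial_const_smul _ _ hc,
    classicalPartial_coord_mul (a := fun t => t ^ idxCount 0 i) (b := fun t => t ^ idxCount 1 i) _
      (contDiff_id.pow _) (contDiff_id.pow _)]
  funext x
  simp only [Pi.smul_apply, smul_eq_mul, iteratedDeriv_pow, potentialCoeff]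
  have hi := idxCount_zero_add_one i
  have hj := idxCount_zero_add_one j
  rcases lt_trichotomy (idxCount 0 j) (idxCount 0 i) with h | h | h
  · rw [if_neg h.ne, Nat.descFactorial_of_lt (n := idxCount 1 i) (by omega)]
    simp
  · have h' : idxCount 1 j = idxCount 1 i := by omega
    rw [if_pos h, h, h', Nat.descFactorial_self, Nat.descFactorial_self]
    simp
    ring
  · rw [if_neg h.ne', Nat.descFactorial_of_lt (n := idxCount 0 i) h]
    simp

/-- For `Vⁱ = x₂ᵐ / m!` the only non-zero derivative of order `m` is `∂₂ᵐVⁱ = 1`. -/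
theorem potentialCoeff_const_one {m : ℕ} (j : MIdx m) :
    potentialCoeff (fun _ => 1) j = if j = fun _ => 1 then 1 else 0 := by
  have h0 : idxCount 0 (fun _ : Fin m => (1 : Fin 2)) = 0 := by simp [idxCount]
  have h1 : idxCount 1 (fun _ : Fin m => (1 : Fin 2)) = m := by simp [idxCount]
  have hj : idxCount 0 j = 0 ↔ j = fun _ => 1 := by
    simp only [idxCount, Finset.sum_eq_zero_iff, funext_iff]
    refine forall_congr' fun l => ?_
    have := Fin.exists_fin_two.1 ⟨j l, rfl⟩
    rcases this with h | h <;> simp [h]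
  have hm : (m.factorial : ℝ) ≠ 0 := by positivity
  simp only [potentialCoeff, h0, h1, hj]
  simp [hm]

theorem dotProduct_mulVec_tensorPower_e₂ {m : ℕ} (M : Tensor2 m) :
    (M *ᵥ tensorPower m e₂) ⬝ᵥ tensorPower m e₂ = M (fun _ => 1) (fun _ => 1) := by
  have h : tensorPower m e₂ = Pi.single (fun _ => 1) 1 := by
    funext i
    simp only [tensorPower, e₂, Pi.single_apply]
    split_ifs with h
    · simp [h]
    · have : ∃ l, i l ≠ 1 := by
        by_contra! hc
        exact h (funext hc)
      obtain ⟨l, hl⟩ := this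
      exact Finset.prod_eq_zero (Finset.mem_univ l) (by simp [hl])
  rw [h]
  simp

/-! ### Square integrable functions -/

theorem inner_toLp_toLp {α : Type*} [MeasurableSpace α] {μ : Measure α} {f g : α → ℝ}
    (hf : MemLp f 2 μ) (hg : MemLp g 2 μ) :
    inner ℝ (hf.toLp f) (hg.toLp g) = ∫ x, f x * g x ∂μ := by
  rw [L2.inner_def]
  refine integral_congr_ae ?_
  filter_upwards [hf.coeFn_toLp, hg.coeFn_toLp] with x hx hy
  rw [hx, hy]
  simp [mul_comm]

theorem MeasureTheory.MemLp.integrable_mul_two {α : Type*} [MeasurableSpace α] {μ : Measure α}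
    {f g : α → ℝ} (hf : MemLp f 2 μ) (hg : MemLp g 2 μ) : Integrable (fun x => f x * g x) μ :=
  hf.integrable_mul hg

/-- The Cauchy–Schwarz inequality. -/
theorem sq_integral_mul_le {α : Type*} [MeasurableSpace α] {μ : Measure α} {f g : α → ℝ}
    (hf : MemLp f 2 μ) (hg : MemLp g 2 μ) :
    (∫ x, f x * g x ∂μ) ^ 2 ≤ (∫ x, f x ^ 2 ∂μ) * ∫ x, g x ^ 2 ∂μ := by
  have h := real_inner_mul_inner_self_le (hf.toLp f) (hg.toLp g)
  simpa only [inner_toLp_toLp, ← sq] using h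

/-! ### Orthogonality to the space `H₀ᵐ(Ω)` -/

/-- Functions of `H₀ᵐ` are approximated by test functions, with all derivatives of order `m`. -/
theorem MemH0.exists_isTest {Ω : Set Plane} (hΩ : IsOpen Ω) (hΩb : Bornology.IsBounded Ω) {m : ℕ}
    {u : Plane → ℝ} (hu : MemH0 m Ω u) {δ : ℝ} (hδ : 0 < δ) :
    ∃ φ, IsTest Ω φ ∧ ∀ j : MIdx m,
      ∫ x in Ω, (weakPartial Ω j u x - classicalPartial j φ x) ^ 2 < δ := by
  obtain ⟨φ, hφ, h⟩ := hu.2 δ hδ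
  refine ⟨φ, hφ, fun j => lt_of_le_of_lt ?_ h⟩
  have hφH := memH_of_contDiff hΩ hΩb m hφ.1
  have hd := hu.1.sub hΩ hφH
  have e1 : ∫ x in Ω, (weakPartial Ω j u x - classicalPartial j φ x) ^ 2
      = ∫ x in Ω, weakPartial Ω j (u - φ) x ^ 2 := by
    refine integral_congr_ae ?_
    filter_upwards [hu.1.weakPartial_sub_ae_eq hΩ hφH le_rfl j,
      weakPartial_ae_eq_classicalPartial hΩ j hφ.1] with x h1 h2
    rw [h1, Pi.sub_apply, h2]
  have e2 : ∫ x in Ω, weakGrad Ω m (u - φ) x ⬝ᵥ weakGrad Ω m (u - φ) x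
      = ∑ j : MIdx m, ∫ x in Ω, weakPartial Ω j (u - φ) x ^ 2 := by
    rw [← integral_finsetSum _ fun j _ => (hd m le_rfl j).2.integrable_sq]
    simp only [weakGrad, dotProduct, sq]
  rw [e1]
  calc _ ≤ ∑ j : MIdx m, ∫ x in Ω, weakPartial Ω j (u - φ) x ^ 2 :=
        Finset.single_le_sum (f := fun j => ∫ x in Ω, weakPartial Ω j (u - φ) x ^ 2)
          (fun j _ => integral_nonneg fun x => sq_nonneg _) (Finset.mem_univ j)
    _ = ∫ x in Ω, weakGrad Ω m (u - φ) x ⬝ᵥ weakGrad Ω m (u - φ) x := e2.symm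
    _ ≤ _ := by
        refine Finset.single_le_sum
          (f := fun k => ∫ x in Ω, weakGrad Ω k (u - φ) x ⬝ᵥ weakGrad Ω k (u - φ) x)
          (fun k _ => integral_nonneg fun x => ?_) (Finset.mem_range.2 (Nat.lt_succ_self m))
        exact Finset.sum_nonneg fun i _ => mul_self_nonneg _

/-- A tensor field in `L²` that is orthogonal to the gradients `∇ᵐφ` of all test functions is
orthogonal to `∇ᵐφ` for all `φ` in `H₀ᵐ`. -/
theorem MemH0.sum_integral_mul_eq_zero {Ω : Set Plane} (hΩ : IsOpen Ω)
    (hΩb : Bornology.IsBounded Ω) {m : ℕ} {G : MIdx m → Plane → ℝ}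
    (hG : ∀ j, MemLp (G j) 2 (volume.restrict Ω))
    (hG0 : ∀ φ, IsTest Ω φ → ∑ j, ∫ x in Ω, G j x * classicalPartial j φ x = 0)
    {u : Plane → ℝ} (hu : MemH0 m Ω u) :
    ∑ j, ∫ x in Ω, G j x * weakPartial Ω j u x = 0 := by
  set B : ℝ := ∑ j, Real.sqrt (∫ x in Ω, G j x ^ 2) with hB
  have hBn : 0 ≤ B := Finset.sum_nonneg fun _ _ => Real.sqrt_nonneg _
  have key : ∀ δ > 0, |∑ j, ∫ x in Ω, G j x * weakPartial Ω j u x| ≤ B * δ := by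
    intro δ hδ
    obtain ⟨φ, hφ, h⟩ := hu.exists_isTest hΩ hΩb (pow_pos hδ 2)
    have hwp : ∀ j, MemLp (weakPartial Ω j u) 2 (volume.restrict Ω) := fun j => (hu.1 m le_rfl j).2
    have hcp : ∀ j : MIdx m, MemLp (classicalPartial j φ) 2 (volume.restrict Ω) := fun j =>
      (contDiff_classicalPartial j hφ.1).continuous.memLp_two_restrict hΩb
    have e : ∑ j, ∫ x in Ω, G j x * weakPartial Ω j u x
        = ∑ j, ∫ x in Ω, G j x * (weakPartial Ω j u - classicalPartial j φ) x := by
      rw [← sub_zero (∑ j, ∫ x in Ω, G j x * weakPartial Ω j u x), ← hG0 φ hφ,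
        ← Finset.sum_sub_distrib]
      refine Finset.sum_congr rfl fun j _ => ?_
      rw [← integral_sub ((hG j).integrable_mul_two (hwp j)) ((hG j).integrable_mul_two (hcp j))]
      simp only [Pi.sub_apply, mul_sub]
    rw [e, hB, Finset.sum_mul]
    refine (Finset.abs_sum_le_sum_abs _ _).trans (Finset.sum_le_sum fun j _ => ?_)
    have hcs := sq_integral_mul_le (hG j) ((hwp j).sub (hcp j))
    have hGn : 0 ≤ ∫ x in Ω, G j x ^ 2 := integral_nonneg fun x => sq_nonneg _
    refine abs_le_of_sq_le_sq ?_ (by positivity)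
    rw [mul_pow, Real.sq_sqrt hGn]
    exact hcs.trans (mul_le_mul_of_nonneg_left (h j).le hGn)
  by_contra hne
  have hpos := abs_pos.2 hne
  have := key (|∑ j, ∫ x in Ω, G j x * weakPartial Ω j u x| / (2 * (B + 1))) (by positivity)
  have h2 : B * (|∑ j, ∫ x in Ω, G j x * weakPartial Ω j u x| / (2 * (B + 1)))
      ≤ |∑ j, ∫ x in Ω, G j x * weakPartial Ω j u x| / 2 := by
    rw [mul_div_assoc', div_le_div_iff₀ (by positivity) (by norm_num)]
    nlinarith
  linarith

/-- A constant function is orthogonal to the derivatives of test functions. -/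
theorem integral_const_mul_classicalPartial {Ω : Set Plane} {k : ℕ} (hk : k ≠ 0) (i : MIdx k)
    (c : ℝ) {φ : Plane → ℝ} (hφ : IsTest Ω φ) : ∫ x in Ω, c * classicalPartial i φ x = 0 := by
  have h := integral_mul_classicalPartial i (u := fun _ => c) contDiff_const hφ
  have h0 : classicalPartial i (fun _ : Plane => c) = 0 := by
    funext x
    simp [classicalPartial, iteratedFDeriv_const_of_ne hk]
  rw [h, h0]
  simp

/-! ### The strip and the coefficient -/

theorem isOpen_strip (y τ : Plane) (ε : ℝ) : IsOpen (strip y τ ε) :=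
  isOpen_lt (Metric.continuous_infDist_pt _) continuous_const

theorem gammaCoeff_of_mem {κ : ℝ} {y τ : Plane} {ε : ℝ} {x : Plane} (hx : x ∈ strip y τ ε) :
    gammaCoeff κ y τ ε x = κ := if_pos hx

theorem gammaCoeff_of_notMem {κ : ℝ} {y τ : Plane} {ε : ℝ} {x : Plane} (hx : x ∉ strip y τ ε) :
    gammaCoeff κ y τ ε x = 1 := if_neg hx

theorem measurable_gammaCoeff (κ : ℝ) (y τ : Plane) (ε : ℝ) :
    Measurable (gammaCoeff κ y τ ε) :=
  Measurable.ite (isOpen_strip y τ ε).measurableSet measurable_const measurable_const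

theorem le_gammaCoeff {κ : ℝ} (h1 : κ ≤ 1) (y τ : Plane) (ε : ℝ) (x : Plane) :
    κ ≤ gammaCoeff κ y τ ε x := by
  unfold gammaCoeff
  split_ifs <;> linarith

theorem gammaCoeff_le_one {κ : ℝ} (h1 : κ ≤ 1) (y τ : Plane) (ε : ℝ) (x : Plane) :
    gammaCoeff κ y τ ε x ≤ 1 := by
  unfold gammaCoeff
  split_ifs <;> linarith

theorem MeasureTheory.MemLp.bounded_mul {α : Type*} [MeasurableSpace α] {μ : Measure α}
    {f c : α → ℝ} (hf : MemLp f 2 μ) (hc : Measurable c) {C : ℝ} (hC : ∀ x, |c x| ≤ C) :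
    MemLp (fun x => c x * f x) 2 μ := by
  refine hf.of_le_mul (c := C) (hc.aestronglyMeasurable.mul hf.1) (Eventually.of_forall fun x => ?_)
  rw [norm_mul]
  exact mul_le_mul_of_nonneg_right (hC x) (norm_nonneg _)

/-- **Quasi-optimality.** The tensor `γ⁻¹ ∇ᵐVⁱ` is the gradient that a perturbed potential would
have if fluxes crossed the strip undisturbed.  Its `L²`-distance to the true gradient `∇ᵐv` is
controlled by the `L²`-distance of its deviation `(γ⁻¹ - 1) ∇ᵐVⁱ` from the unperturbed gradient to
the gradient of any test function.  Indeed `γ (∇ᵐv - γ⁻¹ ∇ᵐVⁱ)` is orthogonal to all gradients. -/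
theorem IsPerturbedPotential.quasi_optimal {Ω : Set Plane} (hΩ : IsOpen Ω)
    (hΩb : Bornology.IsBounded Ω) {m : ℕ} (hm : m ≠ 0) {κ : ℝ} (hκ₀ : 0 < κ) (hκ₁ : κ ≤ 1)
    {y τ : Plane} {ε : ℝ} {i : MIdx m} {v : Plane → ℝ}
    (hv : IsPerturbedPotential Ω κ y τ ε i v) {ψ : Plane → ℝ} (hψ : IsTest Ω ψ) :
    κ * ∑ j, ∫ x in Ω,
        (weakPartial Ω j v x - (gammaCoeff κ y τ ε x)⁻¹ * potentialCoeff i j) ^ 2 ≤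
      ∑ j, ∫ x in Ω, (classicalPartial j ψ x
        - ((gammaCoeff κ y τ ε x)⁻¹ - 1) * potentialCoeff i j) ^ 2 := by
  obtain ⟨hvH, hvH0, hvo⟩ := hv
  set γ := gammaCoeff κ y τ ε with hγ
  have hγm : Measurable γ := measurable_gammaCoeff κ y τ ε
  have hγκ : ∀ x, κ ≤ γ x := le_gammaCoeff hκ₁ y τ ε
  have hγ1 : ∀ x, γ x ≤ 1 := gammaCoeff_le_one hκ₁ y τ ε
  have hγp : ∀ x, 0 < γ x := fun x => hκ₀.trans_le (hγκ x)
  have hγa : ∀ x, |γ x| ≤ 1 := fun x => by rw [abs_of_pos (hγp x)]; exact hγ1 x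
  have hγi : ∀ x, |(γ x)⁻¹| ≤ κ⁻¹ := fun x => by
    rw [abs_of_pos (inv_pos.2 (hγp x))]
    exact inv_anti₀ hκ₀ (hγκ x)
  have hconst : ∀ c : ℝ, MemLp (fun _ : Plane => c) 2 (volume.restrict Ω) := fun c =>
    (continuous_const (y := c)).memLp_two_restrict hΩb
  set R : MIdx m → Plane → ℝ := fun j x => weakPartial Ω j v x - (γ x)⁻¹ * potentialCoeff i j
    with hR
  set Q : MIdx m → Plane → ℝ := fun j x =>
    classicalPartial j ψ x - ((γ x)⁻¹ - 1) * potentialCoeff i j with hQ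
  have hRL : ∀ j, MemLp (R j) 2 (volume.restrict Ω) := fun j =>
    (hvH m le_rfl j).2.sub ((hconst _).bounded_mul hγm.inv hγi)
  have hQL : ∀ j, MemLp (Q j) 2 (volume.restrict Ω) := fun j => by
    have h1 := (contDiff_classicalPartial j hψ.1).continuous.memLp_two_restrict hΩb
    have h2 := (hconst (potentialCoeff i j)).bounded_mul (c := fun x => (γ x)⁻¹ - 1)
      (hγm.inv.sub_const 1) (C := κ⁻¹ + 1) (fun x => by
        refine (abs_sub _ _).trans ?_
        rw [abs_one]
        linarith [hγi x])
    exact h1.sub h2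
  have hVH := memH_of_contDiff hΩ hΩb m (contDiff_potential i)
  have hφ : MemH0 m Ω (v - potential i - ψ) := hvH0.sub_isTest hΩ hΩb hψ
  set φ := v - potential i - ψ with hφd
  have hφL : ∀ j, MemLp (weakPartial Ω j φ) 2 (volume.restrict Ω) := fun j => (hφ.1 m le_rfl j).2
  have hφe : ∀ j : MIdx m, weakPartial Ω j φ =ᵐ[volume.restrict Ω] R j - Q j := by
    intro j
    filter_upwards [hvH0.1.weakPartial_sub_ae_eq hΩ (memH_of_contDiff hΩ hΩb m hψ.1) le_rfl j,
      hvH.weakPartial_sub_ae_eq hΩ hVH le_rfl j, weakPartial_ae_eq_classicalPartial hΩ j hψ.1,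
      weakPartial_ae_eq_classicalPartial hΩ j (contDiff_potential i)] with x h1 h2 h3 h4
    rw [hφd, h1, Pi.sub_apply, h2, Pi.sub_apply, h3, h4, classicalPartial_potential]
    simp only [hR, hQ, Pi.sub_apply]
    ring
  have o1 : ∑ j : MIdx m, ∫ x in Ω, γ x * weakPartial Ω j v x * weakPartial Ω j φ x = 0 := by
    rw [← hvo φ hφ, ← integral_finsetSum]
    · simp only [weakGrad, dotProduct, Finset.mul_sum, mul_assoc, hγ]
    · exact fun j _ => ((hvH m le_rfl j).2.bounded_mul hγm hγa).integrable_mul_two (hφL j)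
  have o2 : ∑ j : MIdx m, ∫ x in Ω, potentialCoeff i j * weakPartial Ω j φ x = 0 :=
    hφ.sum_integral_mul_eq_zero hΩ hΩb (G := fun j _ => potentialCoeff i j) (fun j => hconst _)
      fun ψ' hψ' => Finset.sum_eq_zero fun j _ => integral_const_mul_classicalPartial hm j _ hψ'
  have o3 : ∑ j, ∫ x in Ω, γ x * R j x * (R j x - Q j x) = 0 := by
    rw [← sub_zero (0 : ℝ)]
    nth_rewrite 1 [← o1]
    rw [← o2, ← Finset.sum_sub_distrib]
    refine Finset.sum_congr rfl fun j _ => ?_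
    rw [← integral_sub
      (((hvH m le_rfl j).2.bounded_mul hγm hγa).integrable_mul_two (hφL j))
      ((hconst _).integrable_mul_two (hφL j))]
    refine integral_congr_ae ?_
    filter_upwards [hφe j] with x hx
    rw [hx]
    have := (hγp x).ne'
    simp only [hR, Pi.sub_apply]
    field_simp
  have o4 : ∀ j, κ * (∫ x in Ω, R j x ^ 2) / 2 - (∫ x in Ω, Q j x ^ 2) / 2
      ≤ ∫ x in Ω, γ x * R j x * (R j x - Q j x) := by
    intro j
    have i1 := (hRL j).integrable_sq
    have i2 := (hQL j).integrable_sq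
    rw [← integral_const_mul, ← integral_div, ← integral_div,
      ← integral_sub ((i1.const_mul _).div_const _) (i2.div_const _)]
    refine integral_mono (((i1.const_mul _).div_const _).sub (i2.div_const _))
      (((hRL j).bounded_mul hγm hγa).integrable_mul_two ((hRL j).sub (hQL j))) fun x => ?_
    have a1 := hγκ x
    have a2 := hγ1 x
    have a3 := hγp x
    simp only
    nlinarith [mul_nonneg a3.le (sq_nonneg (R j x - Q j x)),
      mul_nonneg (sub_nonneg.2 a1) (sq_nonneg (R j x)),
      mul_nonneg (sub_nonneg.2 a2) (sq_nonneg (Q j x))]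
  have o5 := Finset.sum_le_sum fun j (_ : j ∈ Finset.univ) => o4 j
  rw [o3, Finset.sum_sub_distrib, ← Finset.sum_div, ← Finset.sum_div, ← Finset.mul_sum] at o5
  linarith

/-! ### Averages over the strip -/

theorem segmentSet_nonempty (y τ : Plane) {ε : ℝ} (hε : 0 < ε) : (segmentSet y τ ε).Nonempty :=
  ⟨y, 0, by linarith, hε.le, by simp⟩

theorem strip_subset_closedBall (y τ : Plane) {ε : ℝ} (hε : 0 < ε) :
    strip y τ ε ⊆ Metric.closedBall y (ε ^ 2 + ε * ‖τ‖) := by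
  intro x hx
  obtain ⟨z, ⟨ρ, h1, h2, rfl⟩, hz⟩ := (Metric.infDist_lt_iff (segmentSet_nonempty y τ hε)).1 hx
  rw [Metric.mem_closedBall]
  refine (dist_triangle x (y + ρ • τ) y).trans (add_le_add hz.le ?_)
  rw [dist_eq_norm, add_sub_cancel_left, norm_smul]
  exact mul_le_mul_of_nonneg_right (abs_le.2 ⟨h1, h2⟩) (norm_nonneg _)

theorem strip_subset_of_tendsto (y τ : Plane) {ε : ℕ → ℝ} (hε : ∀ n, 0 < ε n)
    (h0 : Tendsto ε atTop (𝓝 0)) {U : Set Plane} (hU : U ∈ 𝓝 y) :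
    ∀ᶠ n in atTop, strip y τ (ε n) ⊆ U := by
  obtain ⟨r, hr, hrU⟩ := Metric.nhds_basis_closedBall.mem_iff.1 hU
  have ht : Tendsto (fun n => ε n ^ 2 + ε n * ‖τ‖) atTop (𝓝 0) := by
    simpa using (h0.pow 2).add (h0.mul_const ‖τ‖)
  filter_upwards [ht.eventually_le_const hr] with n hn
  exact (strip_subset_closedBall y τ (hε n)).trans ((Metric.closedBall_subset_closedBall hn).trans hrU)

theorem volume_strip_ne_top (y τ : Plane) {ε : ℝ} (hε : 0 < ε) : volume (strip y τ ε) ≠ ⊤ :=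
  ((measure_mono (strip_subset_closedBall y τ hε)).trans_lt measure_closedBall_lt_top).ne

theorem volume_real_strip_pos (y τ : Plane) {ε : ℝ} (hε : 0 < ε) :
    0 < volume.real (strip y τ ε) := by
  refine ENNReal.toReal_pos ?_ (volume_strip_ne_top y τ hε)
  refine ((isOpen_strip y τ ε).measure_pos volume ⟨y, ?_⟩).ne'
  have : y ∈ segmentSet y τ ε := ⟨0, by linarith, hε.le, by simp⟩
  change Metric.infDist y _ < ε ^ 2
  rw [Metric.infDist_zero_of_mem this]
  positivity

theorem setIntegral_indicator_const_le {Ω S : Set Plane} (hS : MeasurableSet S)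
    (hSf : volume S ≠ ⊤) {c : ℝ} (hc : 0 ≤ c) :
    ∫ x in Ω, S.indicator (fun _ => c) x ≤ c * volume.real S := by
  rw [integral_indicator hS, Measure.restrict_restrict hS, setIntegral_const, smul_eq_mul, mul_comm]
  exact mul_le_mul_of_nonneg_left (measureReal_mono Set.inter_subset_left hSf) hc

theorem IsPerturbedPotential.memLp_indicator {Ω : Set Plane} {m : ℕ} {κ : ℝ} {y τ : Plane} {ε : ℝ}
    {i : MIdx m} {v : Plane → ℝ} (hv : IsPerturbedPotential Ω κ y τ ε i v) (j : MIdx m) :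
    MemLp ((strip y τ ε).indicator (weakPartial Ω j v)) 2 (volume.restrict Ω) :=
  (hv.1 m le_rfl j).2.indicator (isOpen_strip y τ ε).measurableSet

theorem IsPerturbedPotential.memLp_residual {Ω : Set Plane} (hΩb : Bornology.IsBounded Ω) {m : ℕ}
    {κ : ℝ} (hκ₀ : 0 < κ) (hκ₁ : κ ≤ 1) {y τ : Plane} {ε : ℝ} {i : MIdx m} {v : Plane → ℝ}
    (hv : IsPerturbedPotential Ω κ y τ ε i v) (j : MIdx m) :
    MemLp (fun x => weakPartial Ω j v x - (gammaCoeff κ y τ ε x)⁻¹ * potentialCoeff i j) 2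
      (volume.restrict Ω) := by
  refine (hv.1 m le_rfl j).2.sub (MemLp.bounded_mul
    ((continuous_const (y := potentialCoeff i j)).memLp_two_restrict hΩb)
    (c := fun x => (gammaCoeff κ y τ ε x)⁻¹) (measurable_gammaCoeff κ y τ ε).inv (C := κ⁻¹) ?_)
  intro x
  have := le_gammaCoeff hκ₁ y τ ε x
  rw [abs_of_pos (inv_pos.2 (hκ₀.trans_le this))]
  exact inv_anti₀ hκ₀ this

/-- The energy of a perturbed potential in the strip is at most proportional to the area. -/
theorem exists_integral_strip_sq_le {Ω : Set Plane} (hΩ : IsOpen Ω)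
    (hΩb : Bornology.IsBounded Ω) {m : ℕ} (hm : m ≠ 0) {κ : ℝ} (hκ₀ : 0 < κ) (hκ₁ : κ ≤ 1)
    (y τ : Plane) (i : MIdx m) :
    ∃ C : ℝ, 0 ≤ C ∧ ∀ (ε : ℝ) (v : Plane → ℝ), 0 < ε → IsPerturbedPotential Ω κ y τ ε i v →
      ∀ j : MIdx m, ∫ x in Ω, (strip y τ ε).indicator (weakPartial Ω j v) x ^ 2
        ≤ C * volume.real (strip y τ ε) := by
  set K : ℝ := ∑ j, ((κ⁻¹ - 1) * potentialCoeff i j) ^ 2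
  set K' : ℝ := ∑ j, (κ⁻¹ * potentialCoeff i j) ^ 2
  have hKn : 0 ≤ K := Finset.sum_nonneg fun j _ => sq_nonneg _
  have hKn' : 0 ≤ K' := Finset.sum_nonneg fun j _ => sq_nonneg _
  refine ⟨2 * (κ⁻¹ * K) + 2 * K', by positivity, fun ε v hε hv j => ?_⟩
  have hS := (isOpen_strip y τ ε).measurableSet
  have hSf := volume_strip_ne_top y τ hε
  set S := strip y τ ε
  have q := hv.quasi_optimal hΩ hΩb hm hκ₀ hκ₁ (isTest_zero Ω)
  have q1 : ∀ j : MIdx m, ∫ x in Ω, (classicalPartial j 0 x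
        - ((gammaCoeff κ y τ ε x)⁻¹ - 1) * potentialCoeff i j) ^ 2
      ≤ ((κ⁻¹ - 1) * potentialCoeff i j) ^ 2 * volume.real S := by
    intro j
    refine le_trans (le_of_eq ?_) (setIntegral_indicator_const_le (Ω := Ω) hS hSf (sq_nonneg _))
    refine integral_congr_ae (Eventually.of_forall fun x => ?_)
    have h0 : classicalPartial j (0 : Plane → ℝ) x = 0 := by
      simp [classicalPartial]
    by_cases hx : x ∈ S
    · simp only [h0, Set.indicator_of_mem hx, gammaCoeff_of_mem hx]
      ring
    · simp [h0, Set.indicator_of_notMem hx, gammaCoeff_of_notMem hx]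
  set R : MIdx m → Plane → ℝ := fun j x =>
    weakPartial Ω j v x - (gammaCoeff κ y τ ε x)⁻¹ * potentialCoeff i j with hR
  have hRL : MemLp (R j) 2 (volume.restrict Ω) := hv.memLp_residual hΩb hκ₀ hκ₁ j
  have q2 : ∫ x in Ω, R j x ^ 2 ≤ κ⁻¹ * K * volume.real S := by
    have h1 : ∫ x in Ω, R j x ^ 2 ≤ ∑ j, ∫ x in Ω, R j x ^ 2 :=
      Finset.single_le_sum (f := fun j => ∫ x in Ω, R j x ^ 2)
        (fun j _ => integral_nonneg fun x => sq_nonneg _) (Finset.mem_univ j)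
    have h2 := q.trans (Finset.sum_le_sum fun j _ => q1 j)
    rw [← Finset.sum_mul] at h2
    rw [mul_assoc, ← div_eq_inv_mul, le_div_iff₀' hκ₀]
    exact (mul_le_mul_of_nonneg_left h1 hκ₀.le).trans h2
  have q3 : (κ⁻¹ * potentialCoeff i j) ^ 2 ≤ K' :=
    Finset.single_le_sum (f := fun j => (κ⁻¹ * potentialCoeff i j) ^ 2)
      (fun j _ => sq_nonneg _) (Finset.mem_univ j)
  have hi2 : Integrable (S.indicator fun _ => (κ⁻¹ * potentialCoeff i j) ^ 2)
      (volume.restrict Ω) :=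
    ((integrable_indicator_iff hS).2 (integrableOn_const hSf)).restrict
  calc ∫ x in Ω, S.indicator (weakPartial Ω j v) x ^ 2
      ≤ ∫ x in Ω, (2 * R j x ^ 2 + 2 * S.indicator (fun _ => (κ⁻¹ * potentialCoeff i j) ^ 2) x) := by
        refine integral_mono (hv.memLp_indicator j).integrable_sq
          ((hRL.integrable_sq.const_mul 2).add (hi2.const_mul 2)) fun x => ?_
        by_cases hx : x ∈ S
        · simp only [Set.indicator_of_mem hx, hR, gammaCoeff_of_mem hx]
          nlinarith [sq_nonneg (weakPartial Ω j v x - 2 * (κ⁻¹ * potentialCoeff i j))]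
        · simp only [Set.indicator_of_notMem hx]
          nlinarith [sq_nonneg (R j x)]
    _ = 2 * (∫ x in Ω, R j x ^ 2)
        + 2 * ∫ x in Ω, S.indicator (fun _ => (κ⁻¹ * potentialCoeff i j) ^ 2) x := by
        rw [integral_add (hRL.integrable_sq.const_mul 2) (hi2.const_mul 2), integral_const_mul,
          integral_const_mul]
    _ ≤ 2 * (κ⁻¹ * K * volume.real S) + 2 * ((κ⁻¹ * potentialCoeff i j) ^ 2 * volume.real S) := by
        gcongr
        exact setIntegral_indicator_const_le hS hSf (sq_nonneg _)
    _ ≤ 2 * (κ⁻¹ * K * volume.real S) + 2 * (K' * volume.real S) := by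
        gcongr
    _ = _ := by ring

theorem abs_average_le_of_sq_le {s t B : ℝ} (hs : 0 < s) (hB : 0 ≤ B) (h : t ^ 2 ≤ (B * s) ^ 2) :
    |s⁻¹ * t| ≤ B := by
  rw [abs_mul, abs_of_pos (inv_pos.2 hs), ← div_eq_inv_mul, div_le_iff₀ hs]
  exact abs_le_of_sq_le_sq h (by positivity)

/-- As the strip shrinks to the interior point `y`, convergence of the averages of a derivative of
the perturbed potentials implies weak-* convergence to a multiple of the Dirac mass at `y`. -/
theorem tendsto_average_mul {Ω : Set Plane} (hΩ : IsOpen Ω)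
    (hΩb : Bornology.IsBounded Ω) {m : ℕ} (hm : m ≠ 0) {κ : ℝ} (hκ₀ : 0 < κ) (hκ₁ : κ ≤ 1)
    {y τ : Plane} (hy : y ∈ Ω) {ε : ℕ → ℝ} (hε : ∀ n, 0 < ε n) (hε0 : Tendsto ε atTop (𝓝 0))
    {i : MIdx m} {V : ℕ → Plane → ℝ} (hV : ∀ n, IsPerturbedPotential Ω κ y τ (ε n) i (V n))
    (j : MIdx m) {a : ℝ}
    (ha : Tendsto (fun n => (volume.real (strip y τ (ε n)))⁻¹ *
      ∫ x in Ω, (strip y τ (ε n)).indicator (weakPartial Ω j (V n)) x) atTop (𝓝 a))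
    {φ : Plane → ℝ} (hφ : ContinuousOn φ (closure Ω)) :
    Tendsto (fun n => (volume.real (strip y τ (ε n)))⁻¹ *
      ∫ x in Ω, (strip y τ (ε n)).indicator (weakPartial Ω j (V n)) x * φ x)
      atTop (𝓝 (a * φ y)) := by
  obtain ⟨C, hC, hCb⟩ := exists_integral_strip_sq_le hΩ hΩb hm hκ₀ hκ₁ y τ i
  have hfin : IsFiniteMeasure (volume.restrict Ω) := ⟨by simpa using hΩb.measure_lt_top⟩
  have hφm : AEStronglyMeasurable φ (volume.restrict Ω) :=
    (hφ.mono subset_closure).aestronglyMeasurable hΩ.measurableSet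
  have hφL : MemLp φ 2 (volume.restrict Ω) := by
    obtain ⟨B, hB⟩ := hΩb.isCompact_closure.exists_bound_of_continuousOn hφ
    refine MemLp.of_bound hφm B ((ae_restrict_iff' hΩ.measurableSet).2 ?_)
    exact Eventually.of_forall fun x hx => hB x (subset_closure hx)
  have hφy : ContinuousAt φ y := hφ.continuousAt (mem_of_superset (hΩ.mem_nhds hy) subset_closure)
  have key : Tendsto (fun n => (volume.real (strip y τ (ε n)))⁻¹ *
      ∫ x in Ω, (strip y τ (ε n)).indicator (weakPartial Ω j (V n)) x * (φ x - φ y))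
      atTop (𝓝 0) := by
    rw [Metric.tendsto_atTop']
    intro δ hδ
    set η : ℝ := δ / (2 * (Real.sqrt C + 1)) with hη
    have hsC := Real.sqrt_nonneg C
    have hηp : 0 < η := by positivity
    have hnhds : {x | |φ x - φ y| < η} ∈ 𝓝 y := by
      exact Metric.continuousAt_iff'.1 hφy η hηp
    obtain ⟨N, hN⟩ := eventually_atTop.1 (strip_subset_of_tendsto y τ hε hε0 hnhds)
    refine ⟨N, fun n hn => ?_⟩
    have hsub := hN n hn.le
    have hS := (isOpen_strip y τ (ε n)).measurableSet
    have hSf := volume_strip_ne_top y τ (hε n)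
    have hSp := volume_real_strip_pos y τ (hε n)
    have hb := hCb (ε n) (V n) (hε n) (hV n) j
    have hL := (hV n).memLp_indicator j
    set S := strip y τ (ε n)
    have hhL : MemLp (S.indicator fun x => φ x - φ y) 2 (volume.restrict Ω) :=
      (hφL.sub (memLp_const (φ y))).indicator hS
    have e : ∫ x in Ω, S.indicator (weakPartial Ω j (V n)) x * (φ x - φ y)
        = ∫ x in Ω, S.indicator (weakPartial Ω j (V n)) x * S.indicator (fun x => φ x - φ y) x := by
      congr 1
      funext x
      by_cases hx : x ∈ S <;> simp [hx]
    have hh2 : ∫ x in Ω, S.indicator (fun x => φ x - φ y) x ^ 2 ≤ η ^ 2 * volume.real S := by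
      refine le_trans (integral_mono hhL.integrable_sq
        (((integrable_indicator_iff hS).2 (integrableOn_const hSf)).restrict
          (f := S.indicator fun _ => η ^ 2)) fun x => ?_)
        (setIntegral_indicator_const_le (Ω := Ω) hS hSf (sq_nonneg η))
      by_cases hx : x ∈ S
      · have hxη : |φ x - φ y| < η := hsub hx
        simp only [Set.indicator_of_mem hx]
        exact sq_le_sq' (abs_lt.1 hxη).1.le (abs_lt.1 hxη).2.le
      · simp [Set.indicator_of_notMem hx]
    have hcs := sq_integral_mul_le hL hhL
    rw [dist_zero_right, Real.norm_eq_abs, e]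
    have hle : (∫ x in Ω, S.indicator (weakPartial Ω j (V n)) x *
        S.indicator (fun x => φ x - φ y) x) ^ 2 ≤ (Real.sqrt C * η * volume.real S) ^ 2 := by
      refine hcs.trans ((mul_le_mul hb hh2 (integral_nonneg fun x => sq_nonneg _)
        (by positivity)).trans (le_of_eq ?_))
      rw [mul_pow, mul_pow, Real.sq_sqrt hC]
      ring
    refine (abs_average_le_of_sq_le hSp (by positivity) hle).trans_lt ?_
    rw [hη, mul_div_assoc', div_lt_iff₀ (by positivity)]
    nlinarith
  have hsum := key.add (ha.mul_const (φ y))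
  rw [zero_add] at hsum
  refine hsum.congr fun n => ?_
  have hL := (hV n).memLp_indicator j
  have i1 := hL.integrable_mul_two hφL
  have i2 := hL.integrable_mul_two (memLp_const (φ y))
  simp only [mul_sub]
  rw [integral_sub i1 i2, integral_mul_const]
  ring

/-- Bounded averages have convergent subsequences: existence of polarization tensors. -/
theorem exists_subseq_isPolarizationTensor {Ω : Set Plane} (hΩ : IsOpen Ω)
    (hΩb : Bornology.IsBounded Ω) {m : ℕ} (hm : m ≠ 0) {κ : ℝ} (hκ₀ : 0 < κ) (hκ₁ : κ ≤ 1)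
    {y τ : Plane} (hy : y ∈ Ω) {ε : ℕ → ℝ} (hε : ∀ n, 0 < ε n) (hε0 : Tendsto ε atTop (𝓝 0))
    {V : ℕ → MIdx m → Plane → ℝ} (hV : ∀ n i, IsPerturbedPotential Ω κ y τ (ε n) i (V n i)) :
    ∃ s : ℕ → ℕ, StrictMono s ∧
      ∃ M : Tensor2 m, IsPolarizationTensor Ω κ y τ (fun n => ε (s n)) M := by
  have hfin : IsFiniteMeasure (volume.restrict Ω) := ⟨by simpa using hΩb.measure_lt_top⟩
  choose C hC hCb using exists_integral_strip_sq_le hΩ hΩb hm hκ₀ hκ₁ y τ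
  set A : ℕ → MIdx m → MIdx m → ℝ := fun n i j => (volume.real (strip y τ (ε n)))⁻¹ *
      ∫ x in Ω, (strip y τ (ε n)).indicator (weakPartial Ω j (V n i)) x
  have hbound : ∀ n i j, |A n i j| ≤ Real.sqrt (C i) := by
    intro n i j
    have hS := (isOpen_strip y τ (ε n)).measurableSet
    have hSf := volume_strip_ne_top y τ (hε n)
    have hb := hCb i (ε n) (V n i) (hε n) (hV n i) j
    have hL := (hV n i).memLp_indicator j
    refine abs_average_le_of_sq_le (volume_real_strip_pos y τ (hε n)) (Real.sqrt_nonneg _) ?_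
    have h1L : MemLp ((strip y τ (ε n)).indicator fun _ => (1 : ℝ)) 2 (volume.restrict Ω) :=
      (memLp_const 1).indicator hS
    have hcs := sq_integral_mul_le hL h1L
    have e1 : ∀ x, (strip y τ (ε n)).indicator (weakPartial Ω j (V n i)) x *
        (strip y τ (ε n)).indicator (fun _ => (1 : ℝ)) x =
          (strip y τ (ε n)).indicator (weakPartial Ω j (V n i)) x := by
      intro x
      by_cases hx : x ∈ strip y τ (ε n) <;> simp [hx]
    have e2 : ∀ x, (strip y τ (ε n)).indicator (fun _ => (1 : ℝ)) x ^ 2 =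
        (strip y τ (ε n)).indicator (fun _ => (1 : ℝ)) x := by
      intro x
      by_cases hx : x ∈ strip y τ (ε n) <;> simp [hx]
    simp only [e1, e2] at hcs
    refine hcs.trans ((mul_le_mul hb (setIntegral_indicator_const_le hS hSf zero_le_one)
      (integral_nonneg fun x => Set.indicator_nonneg (fun _ _ => zero_le_one) x)
      (mul_nonneg (hC i) measureReal_nonneg)).trans (le_of_eq ?_))
    rw [mul_pow, Real.sq_sqrt (hC i)]
    ring
  have hbd : ∀ n, A n ∈ Set.pi Set.univ fun i => Set.pi Set.univ fun _ : MIdx m =>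
      Set.Icc (-Real.sqrt (C i)) (Real.sqrt (C i)) := fun n i _ j _ => abs_le.1 (hbound n i j)
  have hcpt : IsCompact (Set.pi Set.univ fun i => Set.pi Set.univ fun _ : MIdx m =>
      Set.Icc (-Real.sqrt (C i)) (Real.sqrt (C i))) :=
    isCompact_univ_pi fun i => isCompact_univ_pi fun _ => isCompact_Icc
  obtain ⟨M, -, s, hs, hM⟩ := hcpt.tendsto_subseq hbd
  refine ⟨s, hs, M, fun n => V (s n), fun n i => hV (s n) i, fun i j φ hφ => ?_⟩
  exact tendsto_average_mul hΩ hΩb hm hκ₀ hκ₁ hy (fun n => hε (s n))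
    (hε0.comp hs.tendsto_atTop) (fun n => hV (s n) i) j
    ((tendsto_pi_nhds.1 ((tendsto_pi_nhds.1 hM) i)) j) hφ

/-- If test functions approximate the deviation `(γ⁻¹ - 1) ∇ᵐVⁱ` up to `o(|Ω_ε|^{1/2})` in `L²`,
then the polarization tensor is `κ⁻¹ ∇ᵐVⁱ` in the row `i`. -/
theorem IsPolarizationTensor.eq_of_trial {Ω : Set Plane} (hΩ : IsOpen Ω)
    (hΩb : Bornology.IsBounded Ω) {m : ℕ} (hm : m ≠ 0) {κ : ℝ} (hκ₀ : 0 < κ) (hκ₁ : κ ≤ 1)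
    {y τ : Plane} (hy : y ∈ Ω) {ε : ℕ → ℝ} (hε : ∀ n, 0 < ε n) (hε0 : Tendsto ε atTop (𝓝 0))
    {M : Tensor2 m} (hM : IsPolarizationTensor Ω κ y τ ε M) {i : MIdx m}
    (htrial : ∀ η > 0, ∀ᶠ n in atTop, ∃ ψ, IsTest Ω ψ ∧
      ∑ j, ∫ x in Ω, (classicalPartial j ψ x
        - ((gammaCoeff κ y τ (ε n) x)⁻¹ - 1) * potentialCoeff i j) ^ 2
        ≤ η * volume.real (strip y τ (ε n))) (j : MIdx m) :
    M i j = κ⁻¹ * potentialCoeff i j := by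
  have hfin : IsFiniteMeasure (volume.restrict Ω) := ⟨by simpa using hΩb.measure_lt_top⟩
  obtain ⟨V, hV, hlim⟩ := hM
  have h1 := hlim i j (fun _ => 1) continuousOn_const
  simp only [mul_one] at h1
  refine tendsto_nhds_unique h1 ?_
  rw [Metric.tendsto_atTop']
  intro δ hδ
  have hδ2 : 0 < κ * (δ / 2) ^ 2 := by positivity
  obtain ⟨N, hN⟩ := eventually_atTop.1 ((htrial _ hδ2).and
    (strip_subset_of_tendsto y τ hε hε0 (hΩ.mem_nhds hy)))
  refine ⟨N, fun n hn => ?_⟩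
  obtain ⟨⟨ψ, hψ, hQ⟩, hSΩ⟩ := hN n hn.le
  have q := (((hV n i).quasi_optimal hΩ hΩb hm hκ₀ hκ₁ hψ).trans hQ)
  have hS := (isOpen_strip y τ (ε n)).measurableSet
  have hSf := volume_strip_ne_top y τ (hε n)
  have hSp := volume_real_strip_pos y τ (hε n)
  have hL := (hV n i).memLp_indicator j
  have hRL := (hV n i).memLp_residual hΩb hκ₀ hκ₁ j
  set S := strip y τ (ε n)
  have hR2 : ∫ x in Ω, (weakPartial Ω j (V n i) x
      - (gammaCoeff κ y τ (ε n) x)⁻¹ * potentialCoeff i j) ^ 2 ≤ (δ / 2) ^ 2 * volume.real S := by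
    have hle := Finset.single_le_sum (f := fun j => ∫ x in Ω, (weakPartial Ω j (V n i) x
      - (gammaCoeff κ y τ (ε n) x)⁻¹ * potentialCoeff i j) ^ 2)
        (fun j _ => integral_nonneg fun x => sq_nonneg _) (Finset.mem_univ j)
    have := (mul_le_mul_of_nonneg_left hle hκ₀.le).trans q
    rw [mul_assoc] at this
    exact le_of_mul_le_mul_left this hκ₀
  have h1L : MemLp (S.indicator fun _ => (1 : ℝ)) 2 (volume.restrict Ω) :=
    (memLp_const 1).indicator hS
  have hcs := sq_integral_mul_le hRL h1L
  have hvol : ∫ x in Ω, S.indicator (fun _ => (1 : ℝ)) x = volume.real S := by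
    rw [integral_indicator hS, Measure.restrict_restrict hS, setIntegral_const, smul_eq_mul,
      mul_one, Set.inter_eq_left.2 hSΩ]
  have e1 : ∫ x in Ω, (weakPartial Ω j (V n i) x
      - (gammaCoeff κ y τ (ε n) x)⁻¹ * potentialCoeff i j) * S.indicator (fun _ => (1 : ℝ)) x
      = (∫ x in Ω, S.indicator (weakPartial Ω j (V n i)) x)
        - κ⁻¹ * potentialCoeff i j * volume.real S := by
    rw [← hvol, ← integral_const_mul, ← integral_sub (hL.integrable (by norm_num))
      ((h1L.integrable (by norm_num)).const_mul _)]
    congr 1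
    funext x
    by_cases hx : x ∈ S
    · simp [hx, gammaCoeff_of_mem hx]
    · simp [hx]
  have e2 : ∀ x, S.indicator (fun _ => (1 : ℝ)) x ^ 2 = S.indicator (fun _ => (1 : ℝ)) x := by
    intro x
    by_cases hx : x ∈ S <;> simp [hx]
  simp only [e2] at hcs
  rw [e1, hvol] at hcs
  have hle : ((∫ x in Ω, S.indicator (weakPartial Ω j (V n i)) x)
      - κ⁻¹ * potentialCoeff i j * volume.real S) ^ 2 ≤ (δ / 2 * volume.real S) ^ 2 := by
    refine hcs.trans ((mul_le_mul_of_nonneg_right hR2 hSp.le).trans (le_of_eq ?_))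
    ring
  have hfinal := abs_average_le_of_sq_le hSp (by positivity) hle
  rw [mul_sub, ← mul_assoc, mul_comm _ (κ⁻¹ * potentialCoeff i j), mul_assoc,
    inv_mul_cancel₀ hSp.ne', mul_one] at hfinal
  rw [Real.dist_eq]
  linarith

/-! ### The Poincaré inequality -/

/-- The Poincaré inequality in the first coordinate: integrate `∂₁(x₁ φ²)`. -/
theorem IsTest.poincare {Ω : Set Plane} (hΩ : IsOpen Ω) (hΩb : Bornology.IsBounded Ω) {r : ℝ}
    (hr : ∀ x ∈ Ω, |x 0| ≤ r) {φ : Plane → ℝ} (hφ : IsTest Ω φ) :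
    ∫ x in Ω, φ x ^ 2 ≤
      (2 * r) ^ 2 * ∫ x in Ω, fderiv ℝ φ x (EuclideanSpace.single 0 1) ^ 2 := by
  have hc0 : ContDiff ℝ ∞ (fun x : Plane => x 0) :=
    (EuclideanSpace.proj (𝕜 := ℝ) (0 : Fin 2)).contDiff
  set i : MIdx 1 := fun _ => 0
  set dφ : Plane → ℝ := fun x => fderiv ℝ φ x (EuclideanSpace.single 0 1) with hdφ
  have hdc : Continuous dφ := (contDiff_fderiv_single hφ.1 0).continuous
  have hcp : ∀ {u : Plane → ℝ}, ContDiff ℝ ∞ u →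
      _root_.classicalPartial i u = fun x => fderiv ℝ u x (EuclideanSpace.single 0 1) := by
    intro u hu
    rw [classicalPartial_succ i hu, classicalPartial_zero]
  have hu : ContDiff ℝ ∞ (fun x : Plane => x 0 * φ x) := hc0.mul hφ.1
  have hfd : ∀ x, fderiv ℝ (fun x : Plane => x 0 * φ x) x (EuclideanSpace.single 0 1)
      = φ x + x 0 * dφ x := by
    intro x
    rw [fderiv_fun_mul (hc0.differentiable (by simp) x) (hφ.1.differentiable (by simp) x)]
    have : fderiv ℝ (fun x : Plane => x 0) x = EuclideanSpace.proj (𝕜 := ℝ) (0 : Fin 2) :=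
      (EuclideanSpace.proj (𝕜 := ℝ) (0 : Fin 2)).fderiv
    simp [this, hdφ]
    ring
  have hibp := integral_mul_classicalPartial i hu hφ
  rw [hcp hφ.1, hcp hu] at hibp
  simp only [hfd] at hibp
  have hφL := hφ.continuous.memLp_two_restrict hΩb
  have hxL : MemLp (fun x : Plane => x 0 * dφ x) 2 (volume.restrict Ω) :=
    (hc0.continuous.mul hdc).memLp_two_restrict hΩb
  have hdL : MemLp dφ 2 (volume.restrict Ω) := hdc.memLp_two_restrict hΩb
  have h1 : ∫ x in Ω, φ x ^ 2 = -2 * ∫ x in Ω, φ x * (x 0 * dφ x) := by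
    have e1 : ∫ x in Ω, (φ x + x 0 * dφ x) * φ x
        = (∫ x in Ω, φ x ^ 2) + ∫ x in Ω, φ x * (x 0 * dφ x) := by
      rw [← integral_add hφL.integrable_sq (hφL.integrable_mul_two hxL)]
      congr 1
      funext x
      ring
    have e2 : ∫ x in Ω, x 0 * φ x * dφ x = ∫ x in Ω, φ x * (x 0 * dφ x) := by
      congr 1
      funext x
      ring
    have hibp' : ∫ x in Ω, x 0 * φ x * dφ x
        = (-1) ^ 1 * ∫ x in Ω, (φ x + x 0 * dφ x) * φ x := hibp
    rw [e1, e2] at hibp'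
    linarith
  have h2 := sq_integral_mul_le hφL hxL
  have h3 : ∫ x in Ω, (x 0 * dφ x) ^ 2 ≤ r ^ 2 * ∫ x in Ω, dφ x ^ 2 := by
    rw [← integral_const_mul]
    refine integral_mono_ae hxL.integrable_sq (hdL.integrable_sq.const_mul _) ?_
    refine (ae_restrict_iff' hΩ.measurableSet).2 (Eventually.of_forall fun x hx => ?_)
    simp only [mul_pow]
    exact mul_le_mul_of_nonneg_right (sq_le_sq' (abs_le.1 (hr x hx)).1 (abs_le.1 (hr x hx)).2)
      (sq_nonneg _)
  have hn : 0 ≤ ∫ x in Ω, φ x ^ 2 := integral_nonneg fun x => sq_nonneg _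
  have hn' : 0 ≤ ∫ x in Ω, dφ x ^ 2 := integral_nonneg fun x => sq_nonneg _
  rcases hn.eq_or_lt with h0 | h0
  · rw [← h0]
    positivity
  · have h4 : (∫ x in Ω, φ x ^ 2) * (∫ x in Ω, φ x ^ 2)
        ≤ (∫ x in Ω, φ x ^ 2) * ((2 * r) ^ 2 * ∫ x in Ω, dφ x ^ 2) := by
      have h5 := mul_le_mul_of_nonneg_left h3 hn
      have h6 : (∫ x in Ω, φ x ^ 2) * (∫ x in Ω, φ x ^ 2)
          = 4 * (∫ x in Ω, φ x * (x 0 * dφ x)) ^ 2 := by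
        rw [h1]
        ring
      nlinarith
    exact le_of_mul_le_mul_left h4 h0

/-- On test functions, the derivatives of order `m` control those of lower order. -/
theorem exists_integral_classicalPartial_sq_le {Ω : Set Plane} (hΩ : IsOpen Ω)
    (hΩb : Bornology.IsBounded Ω) {m k : ℕ} (hk : k ≤ m) (i : MIdx k) :
    ∃ C : ℝ, 0 ≤ C ∧ ∀ φ, IsTest Ω φ → ∫ x in Ω, classicalPartial i φ x ^ 2 ≤
      C * ∑ j : MIdx m, ∫ x in Ω, classicalPartial j φ x ^ 2 := by
  obtain ⟨r, hr⟩ := hΩb.exists_norm_le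
  have hr' : ∀ x ∈ Ω, |x 0| ≤ r := fun x hx => (PiLp.norm_apply_le x 0).trans (hr x hx)
  induction hk using Nat.decreasingInduction with
  | self =>
    refine ⟨1, zero_le_one, fun φ _ => ?_⟩
    rw [one_mul]
    exact Finset.single_le_sum (f := fun j => ∫ x in Ω, classicalPartial j φ x ^ 2)
      (fun j _ => integral_nonneg fun x => sq_nonneg _) (Finset.mem_univ i)
  | of_succ k hk ih =>
    obtain ⟨C, hC, h⟩ := ih (Fin.cons 0 i : MIdx (k + 1))
    refine ⟨(2 * r) ^ 2 * C, by positivity, fun φ hφ => ?_⟩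
    refine ((hφ.classicalPartial i).poincare hΩ hΩb hr').trans ?_
    rw [mul_assoc]
    refine mul_le_mul_of_nonneg_left ((le_of_eq ?_).trans (h φ hφ)) (sq_nonneg _)
    rw [classicalPartial_succ _ hφ.1]
    rfl

/-! ### Existence of perturbed potentials -/

/-- The space `C_c^∞(Ω)` of test functions. -/
def testSpace (Ω : Set Plane) : Submodule ℝ (Plane → ℝ) where
  carrier := {φ | IsTest Ω φ}
  add_mem' := IsTest.add
  zero_mem' := isTest_zero Ω
  smul_mem' c _ h := h.const_smul c

theorem memLp_mul_classicalPartial {Ω : Set Plane} (hΩb : Bornology.IsBounded Ω) {c : Plane → ℝ}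
    (hc : Measurable c) (hc1 : ∀ x, |c x| ≤ 1) {k : ℕ} (i : MIdx k) (φ : testSpace Ω) :
    MemLp (fun x => c x * classicalPartial i φ.1 x) 2 (volume.restrict Ω) :=
  ((contDiff_classicalPartial i φ.2.1).continuous.memLp_two_restrict hΩb).bounded_mul hc hc1

/-- The weighted derivative `φ ↦ c ∂ᵏφ / ∂x_{i₁} ⋯ ∂x_{iₖ}` from test functions to `L²(Ω)`. -/
noncomputable def weightedPartial {Ω : Set Plane} (hΩb : Bornology.IsBounded Ω) {c : Plane → ℝ}
    (hc : Measurable c) (hc1 : ∀ x, |c x| ≤ 1) {k : ℕ} (i : MIdx k) :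
    testSpace Ω →ₗ[ℝ] Lp ℝ 2 (volume.restrict Ω) where
  toFun φ := (memLp_mul_classicalPartial hΩb hc hc1 i φ).toLp _
  map_add' φ ψ := by
    rw [← MemLp.toLp_add, MemLp.toLp_eq_toLp_iff]
    refine Eventually.of_forall fun x => ?_
    simp only [Submodule.coe_add, classicalPartial_add i φ.2.1 ψ.2.1, Pi.add_apply]
    ring
  map_smul' a φ := by
    rw [RingHom.id_apply, ← MemLp.toLp_const_smul, MemLp.toLp_eq_toLp_iff]
    refine Eventually.of_forall fun x => ?_
    simp only [Submodule.coe_smul, classicalPartial_const_smul i a φ.2.1, Pi.smul_apply,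
      smul_eq_mul]
    ring

/-- The weighted gradient `φ ↦ c ∇ᵐφ` from test functions to `L²(Ω)`. -/
noncomputable def weightedGrad {Ω : Set Plane} (hΩb : Bornology.IsBounded Ω) {c : Plane → ℝ}
    (hc : Measurable c) (hc1 : ∀ x, |c x| ≤ 1) (m : ℕ) :
    testSpace Ω →ₗ[ℝ] PiLp 2 fun _ : MIdx m => Lp ℝ 2 (volume.restrict Ω) where
  toFun φ := WithLp.toLp 2 fun j => weightedPartial hΩb hc hc1 j φ
  map_add' φ ψ := by
    ext1 j
    simp
  map_smul' a φ := by
    ext1 j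
    simp

theorem norm_sq_weightedPartial {Ω : Set Plane} (hΩb : Bornology.IsBounded Ω) {c : Plane → ℝ}
    (hc : Measurable c) (hc1 : ∀ x, |c x| ≤ 1) {k : ℕ} (i : MIdx k) (φ : testSpace Ω) :
    ‖weightedPartial hΩb hc hc1 i φ‖ ^ 2 = ∫ x in Ω, (c x * classicalPartial i φ.1 x) ^ 2 := by
  rw [← real_inner_self_eq_norm_sq, weightedPartial, LinearMap.coe_mk, AddHom.coe_mk,
    inner_toLp_toLp]
  simp only [sq]

/-- A sequence of test functions whose derivatives of order `m` form Cauchy sequences in `L²(Ω)`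
converges in `H₀ᵐ(Ω)`; the derivatives of order `m` converge weakly to those of the limit. -/
theorem exists_memH0_limit {Ω : Set Plane} (hΩ : IsOpen Ω) (hΩb : Bornology.IsBounded Ω) {m : ℕ}
    {φ : ℕ → testSpace Ω}
    (hφ : ∀ δ > 0, ∃ N, ∀ n ≥ N, ∑ j : MIdx m,
      ∫ x in Ω, classicalPartial j (φ n - φ N : testSpace Ω).1 x ^ 2 < δ) :
    ∃ u, MemH0 m Ω u ∧ ∀ (j : MIdx m) (h : Plane → ℝ), MemLp h 2 (volume.restrict Ω) →
      Tendsto (fun n => ∫ x in Ω, classicalPartial j (φ n).1 x * h x) atTop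
        (𝓝 (∫ x in Ω, weakPartial Ω j u x * h x)) := by
  have hfin : IsFiniteMeasure (volume.restrict Ω) := ⟨by simpa using hΩb.measure_lt_top⟩
  have hone : Measurable fun _ : Plane => (1 : ℝ) := measurable_const
  have hone1 : ∀ _ : Plane, |(1 : ℝ)| ≤ 1 := fun _ => by simp
  obtain ⟨D, hD, hDa⟩ : ∃ D : ∀ (k : ℕ) (_ : MIdx k),
      testSpace Ω →ₗ[ℝ] Lp ℝ 2 (volume.restrict Ω),
      (∀ k i' ψ, ‖D k i' ψ‖ ^ 2 = ∫ x in Ω, classicalPartial i' ψ.1 x ^ 2) ∧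
      ∀ k i' ψ, D k i' ψ =ᵐ[volume.restrict Ω] classicalPartial i' ψ.1 := by
    refine ⟨fun _ i' => weightedPartial hΩb hone hone1 i', fun k i' ψ => ?_, fun k i' ψ => ?_⟩
    · rw [norm_sq_weightedPartial]
      simp only [one_mul]
    · filter_upwards [(memLp_mul_classicalPartial hΩb hone hone1 i' ψ).coeFn_toLp] with x hx
      exact hx.trans (one_mul _)
  have hDlim : ∀ k ≤ m, ∀ i' : MIdx k, ∃ g : Lp ℝ 2 (volume.restrict Ω),
      Tendsto (fun n => D k i' (φ n)) atTop (𝓝 g) := by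
    intro k hk i'
    obtain ⟨C, hC, h⟩ := exists_integral_classicalPartial_sq_le hΩ hΩb hk i'
    refine cauchySeq_tendsto_of_complete (Metric.cauchySeq_iff'.2 fun δ hδ => ?_)
    obtain ⟨N, hN⟩ := hφ (δ ^ 2 / (C + 1)) (by positivity)
    refine ⟨N, fun n hn => ?_⟩
    have h1 := hN n hn
    rw [dist_eq_norm, ← map_sub]
    refine lt_of_pow_lt_pow_left₀ 2 hδ.le ?_
    rw [hD]
    refine (h _ (φ n - φ N).2).trans_lt ?_
    rw [lt_div_iff₀ (by positivity)] at h1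
    have h0 : 0 ≤ ∑ j : MIdx m, ∫ x in Ω, classicalPartial j (φ n - φ N : testSpace Ω).1 x ^ 2 :=
      Finset.sum_nonneg fun j _ => integral_nonneg fun x => sq_nonneg _
    rcases h0.eq_or_lt with h0 | h0
    · rw [← h0, mul_zero]
      positivity
    · nlinarith
  choose g hg using hDlim
  set u : Plane → ℝ := ⇑(g 0 (Nat.zero_le m) Fin.elim0)
  have hloc : ∀ g : Lp ℝ 2 (volume.restrict Ω), LocallyIntegrableOn g Ω := fun g =>
    IntegrableOn.locallyIntegrableOn ((Lp.memLp g).integrable (by norm_num))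
  have hpair : ∀ k (hk : k ≤ m) (i' : MIdx k) {h : Plane → ℝ} (_ : MemLp h 2 (volume.restrict Ω)),
      Tendsto (fun n => ∫ x in Ω, classicalPartial i' (φ n).1 x * h x) atTop
        (𝓝 (∫ x in Ω, g k hk i' x * h x)) := by
    intro k hk i' h hh
    have h1 := (hg k hk i').inner (tendsto_const_nhds (x := hh.toLp h)) (𝕜 := ℝ)
    have h2 : ∀ f : Lp ℝ 2 (volume.restrict Ω),
        inner ℝ f (hh.toLp h) = ∫ x in Ω, f x * h x := by
      intro f
      rw [← inner_toLp_toLp (Lp.memLp f) hh, Lp.toLp_coeFn]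
    simp only [h2] at h1
    refine h1.congr fun n => integral_congr_ae ?_
    filter_upwards [hDa k i' (φ n)] with x hx
    rw [hx]
  have hgw : ∀ k (hk : k ≤ m) (i' : MIdx k), IsWeakPartial Ω i' u (g k hk i') := by
    intro k hk i'
    refine ⟨hloc _, hloc _, fun ψ hψ => ?_⟩
    have h1 := hpair 0 (Nat.zero_le m) Fin.elim0
      ((contDiff_classicalPartial i' hψ.1).continuous.memLp_two_restrict hΩb)
    have h2 := (hpair k hk i' (hψ.continuous.memLp_two_restrict hΩb)).const_mul ((-1) ^ k)
    refine tendsto_nhds_unique h1 (h2.congr fun n => ?_)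
    rw [classicalPartial_zero, ← integral_mul_classicalPartial i' (φ n).2.1 hψ]
  have huH : MemH m Ω u := memH_of_isWeakPartial hΩ fun k hk i' =>
    ⟨_, hgw k hk i', Lp.memLp _⟩
  refine ⟨u, ⟨huH, fun δ hδ => ?_⟩, fun j h hh => ?_⟩
  · have hlim : Tendsto (fun n => normSqH m Ω (u - (φ n).1)) atTop (𝓝 0) := by
      rw [← Finset.sum_const_zero (s := Finset.range (m + 1))]
      refine tendsto_finsetSum _ fun k hk => ?_
      have hk' : k ≤ m := Nat.lt_succ_iff.1 (Finset.mem_range.1 hk)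
      have h1 : Tendsto (fun n => ∑ i' : MIdx k, ‖g k hk' i' - D k i' (φ n)‖ ^ 2) atTop
          (𝓝 (∑ i' : MIdx k, 0)) := by
        refine tendsto_finsetSum _ fun i' _ => ?_
        simpa using ((tendsto_const_nhds (x := g k hk' i')).sub (hg k hk' i')).norm.pow 2
      rw [Finset.sum_const_zero] at h1
      refine h1.congr fun n => ?_
      have hd := huH.sub hΩ (memH_of_contDiff hΩ hΩb m (φ n).2.1)
      simp only [weakGrad, dotProduct]
      rw [integral_finsetSum _ fun i' _ =>
        (hd k hk' i').2.integrable_mul_two (hd k hk' i').2]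
      refine Finset.sum_congr rfl fun i' _ => ?_
      rw [← real_inner_self_eq_norm_sq, L2.inner_def]
      refine integral_congr_ae ?_
      filter_upwards [((hgw k hk' i').sub (isWeakPartial_classicalPartial Ω i'
        (φ n).2.1)).weakPartial_ae_eq hΩ, Lp.coeFn_sub (g k hk' i') (D k i' (φ n)),
        hDa k i' (φ n)] with x h1 h2 h3
      rw [h1, h2, Pi.sub_apply, Pi.sub_apply, h3]
      simp [sq]
    obtain ⟨n, hn⟩ := (hlim.eventually_lt_const hδ).exists
    exact ⟨(φ n).1, (φ n).2, hn⟩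
  · have h1 := hpair m le_rfl j hh
    have h2 : ∫ x in Ω, weakPartial Ω j u x * h x = ∫ x in Ω, g m le_rfl j x * h x := by
      refine integral_congr_ae ?_
      filter_upwards [(hgw m le_rfl j).weakPartial_ae_eq hΩ] with x hx
      rw [hx]
    rwa [h2]

/-- Weak solvability on test functions: the correction of `∇ᵐVⁱ`, weighted by `γ^{1/2}`, is the
orthogonal projection of `-γ^{1/2} ∇ᵐVⁱ` to the closure of the weighted gradients of test functions;
a sequence that approximates the projection converges in `H₀ᵐ` by the Poincaré inequality. -/
theorem exists_memH0_correction {Ω : Set Plane} (hΩ : IsOpen Ω)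
    (hΩb : Bornology.IsBounded Ω) {m : ℕ} {κ : ℝ} (hκ₀ : 0 < κ) {γ : Plane → ℝ}
    (hγm : Measurable γ) (hγκ : ∀ x, κ ≤ γ x) (hγ1 : ∀ x, γ x ≤ 1) (t : MIdx m → ℝ) :
    ∃ u, MemH0 m Ω u ∧ ∀ ψ, IsTest Ω ψ →
      ∑ j, ∫ x in Ω, (weakPartial Ω j u x + t j) * (γ x * classicalPartial j ψ x) = 0 := by
  have hfin : IsFiniteMeasure (volume.restrict Ω) := ⟨by simpa using hΩb.measure_lt_top⟩
  have hγp : ∀ x, 0 < γ x := fun x => hκ₀.trans_le (hγκ x)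
  have hγa : ∀ x, |γ x| ≤ 1 := fun x => by rw [abs_of_pos (hγp x)]; exact hγ1 x
  obtain ⟨c, hc, hcsq, hc1⟩ : ∃ c : Plane → ℝ, Measurable c ∧ (∀ x, c x * c x = γ x) ∧
      ∀ x, |c x| ≤ 1 := by
    refine ⟨fun x => Real.sqrt (γ x), hγm.sqrt, fun x => Real.mul_self_sqrt (hγp x).le,
      fun x => ?_⟩
    rw [abs_of_nonneg (Real.sqrt_nonneg _)]
    exact Real.sqrt_le_one.2 (hγ1 x)
  have hTL : ∀ j : MIdx m, MemLp (fun x => c x * t j) 2 (volume.restrict Ω) :=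
    fun j => (memLp_const (t j)).bounded_mul hc hc1
  obtain ⟨T, hT⟩ : ∃ T : PiLp 2 fun _ : MIdx m => Lp ℝ 2 (volume.restrict Ω),
      ∀ j, T j = (hTL j).toLp _ := ⟨WithLp.toLp 2 fun j => (hTL j).toLp _, fun j => rfl⟩
  obtain ⟨G, hG⟩ : ∃ G : testSpace Ω →ₗ[ℝ] PiLp 2 fun _ : MIdx m => Lp ℝ 2 (volume.restrict Ω),
      ∀ ψ j, G ψ j = (memLp_mul_classicalPartial hΩb hc hc1 j ψ).toLp _ :=
    ⟨weightedGrad hΩb hc hc1 m, fun ψ j => rfl⟩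
  set K := (LinearMap.range G).topologicalClosure
  have hKc : CompleteSpace K := (Submodule.isClosed_topologicalClosure _).completeSpace_coe
  obtain ⟨w, hwK, horth⟩ : ∃ w ∈ K, ∀ ψ, inner ℝ (G ψ) (T + w) = 0 := by
    refine ⟨-K.starProjection T, K.neg_mem (K.starProjection_apply_mem T), fun ψ => ?_⟩
    have h1 : G ψ ∈ K := Submodule.le_topologicalClosure _ ⟨ψ, rfl⟩
    rw [← sub_eq_add_neg]
    exact (Submodule.mem_orthogonal K _).1 (K.sub_starProjection_mem_orthogonal T) _ h1
  obtain ⟨f, hf, hflim⟩ := mem_closure_iff_seq_limit.1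
    (show w ∈ closure (LinearMap.range G : Set _) from hwK)
  choose φ hφ using hf
  have hGφ : Tendsto (fun n => G (φ n)) atTop (𝓝 w) := by simpa only [hφ] using hflim
  have hGle : ∀ ψ : testSpace Ω, ∑ j : MIdx m, ∫ x in Ω, classicalPartial j ψ.1 x ^ 2 ≤
      κ⁻¹ * ‖G ψ‖ ^ 2 := by
    intro ψ
    rw [PiLp.norm_sq_eq_of_L2, Finset.mul_sum]
    refine Finset.sum_le_sum fun j _ => ?_
    have hLc := memLp_mul_classicalPartial hΩb hc hc1 j ψ
    rw [hG, ← real_inner_self_eq_norm_sq, inner_toLp_toLp, ← integral_const_mul]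
    have hL := (contDiff_classicalPartial j ψ.2.1).continuous.memLp_two_restrict hΩb
    refine integral_mono hL.integrable_sq ((hLc.integrable_mul_two hLc).const_mul _) fun x => ?_
    simp only
    rw [mul_mul_mul_comm, hcsq, ← mul_assoc, ← sq]
    refine le_mul_of_one_le_left (sq_nonneg _) ?_
    rw [← div_eq_inv_mul, le_div_iff₀ hκ₀, one_mul]
    exact hγκ x
  obtain ⟨u, hu, hulim⟩ := exists_memH0_limit hΩ hΩb (m := m) (φ := φ) fun δ hδ => by
    obtain ⟨N, hN⟩ := Metric.cauchySeq_iff'.1 hGφ.cauchySeq (Real.sqrt (κ * δ))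
      (Real.sqrt_pos.2 (by positivity))
    refine ⟨N, fun n hn => (hGle _).trans_lt ?_⟩
    have h1 := hN n hn
    rw [dist_eq_norm, ← map_sub, Real.lt_sqrt (norm_nonneg _)] at h1
    rwa [inv_mul_lt_iff₀ hκ₀]
  refine ⟨u, hu, fun ψ hψ => ?_⟩
  set p : testSpace Ω := ⟨ψ, hψ⟩ with hp
  have hψL : ∀ j : MIdx m, MemLp (fun x => γ x * classicalPartial j ψ x) 2 (volume.restrict Ω) :=
    fun j => memLp_mul_classicalPartial hΩb hγm hγa j p
  have hlim1 : Tendsto (fun n => inner ℝ (G p) (T + G (φ n))) atTop (𝓝 0) := by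
    rw [← horth p]
    exact (tendsto_const_nhds (x := G p)).inner (tendsto_const_nhds.add hGφ)
  have hlim2 : Tendsto (fun n => ∑ j : MIdx m,
      ((∫ x in Ω, t j * (γ x * classicalPartial j ψ x))
        + ∫ x in Ω, classicalPartial j (φ n).1 x * (γ x * classicalPartial j ψ x))) atTop
      (𝓝 (∑ j : MIdx m, ((∫ x in Ω, t j * (γ x * classicalPartial j ψ x))
        + ∫ x in Ω, weakPartial Ω j u x * (γ x * classicalPartial j ψ x)))) :=
    tendsto_finsetSum _ fun j _ => tendsto_const_nhds.add (hulim j _ (hψL j))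
  have heq : ∀ n, inner ℝ (G p) (T + G (φ n)) = ∑ j : MIdx m,
      ((∫ x in Ω, t j * (γ x * classicalPartial j ψ x))
        + ∫ x in Ω, classicalPartial j (φ n).1 x * (γ x * classicalPartial j ψ x)) := by
    intro n
    rw [inner_add_right, PiLp.inner_apply, PiLp.inner_apply, ← Finset.sum_add_distrib]
    refine Finset.sum_congr rfl fun j _ => ?_
    rw [hG, hG, hT, inner_toLp_toLp, inner_toLp_toLp]
    simp only [← hcsq, hp]
    congr 2
    · funext x
      ring
    · funext x
      ring
  have hzero := tendsto_nhds_unique (hlim2.congr fun n => (heq n).symm) hlim1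
  rw [← hzero]
  refine Finset.sum_congr rfl fun j _ => ?_
  rw [← integral_add ((memLp_const (t j)).integrable_mul_two (hψL j))
    ((hu.1 m le_rfl j).2.integrable_mul_two (hψL j))]
  congr 1
  funext x
  ring

theorem exists_isPerturbedPotential {Ω : Set Plane} (hΩ : IsOpen Ω)
    (hΩb : Bornology.IsBounded Ω) {m : ℕ} {κ : ℝ} (hκ₀ : 0 < κ) (hκ₁ : κ ≤ 1)
    (y τ : Plane) (ε : ℝ) (i : MIdx m) : ∃ v, IsPerturbedPotential Ω κ y τ ε i v := by
  have hγm := measurable_gammaCoeff κ y τ ε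
  have hγκ := le_gammaCoeff hκ₁ y τ ε
  have hγ1 := gammaCoeff_le_one hκ₁ y τ ε
  have hγa : ∀ x, |gammaCoeff κ y τ ε x| ≤ 1 := fun x => by
    rw [abs_of_pos (hκ₀.trans_le (hγκ x))]
    exact hγ1 x
  obtain ⟨u, hu, hu0⟩ := exists_memH0_correction hΩ hΩb hκ₀ hγm hγκ hγ1 (potentialCoeff i)
  have hVH := memH_of_contDiff hΩ hΩb m (contDiff_potential i)
  have hvH := hu.1.add hΩ hVH
  refine ⟨u + potential i, hvH, by rwa [add_sub_cancel_right], fun ψ hψ => ?_⟩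
  have hvL : ∀ j : MIdx m, MemLp (weakPartial Ω j (u + potential i)) 2 (volume.restrict Ω) :=
    fun j => (hvH m le_rfl j).2
  have hfinal := hψ.sum_integral_mul_eq_zero hΩ hΩb
    (G := fun j x => gammaCoeff κ y τ ε x * weakPartial Ω j (u + potential i) x)
    (fun j => (hvL j).bounded_mul hγm hγa) fun ψ' hψ' => by
      rw [← hu0 ψ' hψ']
      refine Finset.sum_congr rfl fun j _ => integral_congr_ae ?_
      filter_upwards [((hu.1.isWeakPartial le_rfl j).add (isWeakPartial_classicalPartial Ω j
        (contDiff_potential i))).weakPartial_ae_eq hΩ] with x hx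
      simp only [hx, Pi.add_apply, classicalPartial_potential]
      ring
  rw [← hfinal, ← integral_finsetSum]
  · simp only [weakGrad, dotProduct, Finset.mul_sum, mul_assoc]
  · exact fun j _ => ((hvL j).bounded_mul hγm hγa).integrable_mul_two (hψ.1 m le_rfl j).2

/-! ### Profiles in one variable -/

theorem exists_cutoff {a b : ℝ} (ha : 0 < a) (hab : a < b) :
    ∃ A : ℝ → ℝ, ContDiff ℝ ∞ A ∧ HasCompactSupport A ∧ (∀ t, 0 ≤ A t) ∧ (∀ t, A t ≤ 1) ∧
      (∀ t, |t| ≤ a → A t = 1) ∧ (∀ t, b ≤ |t| → A t = 0) := by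
  let f : ContDiffBump (0 : ℝ) := ⟨a, b, ha, hab⟩
  refine ⟨f, f.contDiff, f.hasCompactSupport, fun t => f.nonneg, fun t => f.le_one,
    fun t ht => f.one_of_mem_closedBall ?_, fun t ht => f.zero_of_le_dist ?_⟩
  · simpa using ht
  · simpa using ht

theorem iteratedDeriv_eq_zero_of_notMem_tsupport {f : ℝ → ℝ} {k : ℕ} {t : ℝ}
    (ht : t ∉ tsupport f) : iteratedDeriv k f t = 0 := by
  have h : iteratedFDeriv ℝ k f t = 0 :=
    Function.notMem_support.1 fun h => ht (support_iteratedFDeriv_subset (𝕜 := ℝ) k h)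
  rw [iteratedDeriv, h]
  rfl

theorem exists_abs_iteratedDeriv_le {f : ℝ → ℝ} (hf : ContDiff ℝ ∞ f) (hs : HasCompactSupport f)
    (m : ℕ) : ∃ H : ℝ, 0 ≤ H ∧ ∀ k ≤ m, ∀ t, |iteratedDeriv k f t| ≤ H := by
  have h1 : ∀ k, ∃ H : ℝ, ∀ t, |iteratedDeriv k f t| ≤ H := fun k => by
    have hc : HasCompactSupport (iteratedDeriv k f) :=
      HasCompactSupport.intro hs fun t ht => iteratedDeriv_eq_zero_of_notMem_tsupport ht
    exact hc.exists_bound_of_continuous (hf.continuous_iteratedDeriv k (by exact_mod_cast le_top))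
  choose H hH using h1
  refine ⟨∑ k ∈ Finset.range (m + 1), H k,
    Finset.sum_nonneg fun k _ => (abs_nonneg _).trans (hH k 0), fun k hk t => (hH k t).trans ?_⟩
  exact Finset.single_le_sum (f := H) (fun k _ => (abs_nonneg _).trans (hH k 0))
    (Finset.mem_range.2 (Nat.lt_succ_of_le hk))

theorem exists_contDiff_primitive {f : ℝ → ℝ} (hf : ContDiff ℝ ∞ f) :
    ContDiff ℝ ∞ (fun z => ∫ t in (0 : ℝ)..z, f t) ∧ deriv (fun z => ∫ t in (0 : ℝ)..z, f t) = f := by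
  have hd : ∀ z, HasDerivAt (fun z => ∫ t in (0 : ℝ)..z, f t) (f z) z := fun z =>
    intervalIntegral.integral_hasDerivAt_right (hf.continuous.intervalIntegrable _ _)
      (hf.continuous.stronglyMeasurableAtFilter _ _) hf.continuous.continuousAt
  have he : deriv (fun z => ∫ t in (0 : ℝ)..z, f t) = f := funext fun z => (hd z).deriv
  exact ⟨contDiff_infty_iff_deriv.2 ⟨fun z => (hd z).differentiableAt, by rwa [he]⟩, he⟩

/-- Iterated primitives of the concentrated profile `g(·/λ)` are of size `λ` on a fixed interval. -/
theorem exists_iterated_primitive {g : ℝ → ℝ} (hg : ContDiff ℝ ∞ g) (hgs : HasCompactSupport g)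
    (m : ℕ) : ∃ C : ℝ, 0 ≤ C ∧ ∀ l > 0, ∃ P : ℝ → ℝ, ContDiff ℝ ∞ P ∧
      iteratedDeriv (m + 1) P = (fun z => g (l⁻¹ * z)) ∧
      ∀ k ≤ m, ∀ z, |z| ≤ 2 → |iteratedDeriv k P z| ≤ C * l := by
  have hgc : ∀ l : ℝ, ContDiff ℝ ∞ (fun z => g (l⁻¹ * z)) := fun l =>
    hg.comp (contDiff_const.mul contDiff_id)
  induction m with
  | zero =>
    refine ⟨∫ t, |g t|, integral_nonneg fun t => abs_nonneg _, fun l hl => ?_⟩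
    obtain ⟨h1, h2⟩ := exists_contDiff_primitive (hgc l)
    refine ⟨_, h1, by rw [zero_add, iteratedDeriv_one, h2], fun k hk z _ => ?_⟩
    obtain rfl : k = 0 := by omega
    have hl' : l⁻¹ ≠ 0 := inv_ne_zero hl.ne'
    rw [iteratedDeriv_zero, intervalIntegral.integral_comp_mul_left (fun t => g t) hl', inv_inv,
      smul_eq_mul, abs_mul, abs_of_pos hl, mul_comm]
    refine mul_le_mul_of_nonneg_right ?_ hl.le
    refine (intervalIntegral.norm_integral_le_integral_norm_uIoc (f := g)).trans ?_
    exact setIntegral_le_integral (hg.continuous.integrable_of_hasCompactSupport hgs).norm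
      (Eventually.of_forall fun t => norm_nonneg _)
  | succ m ih =>
    obtain ⟨C, hC, h⟩ := ih
    refine ⟨2 * C, by positivity, fun l hl => ?_⟩
    obtain ⟨P, hP, hPg, hPb⟩ := h l hl
    obtain ⟨h1, h2⟩ := exists_contDiff_primitive hP
    refine ⟨_, h1, by rw [iteratedDeriv_succ', h2, hPg], fun k hk z hz => ?_⟩
    cases k with
    | zero =>
      rw [iteratedDeriv_zero]
      have h3 : ‖∫ t in (0 : ℝ)..z, P t‖ ≤ C * l * |z - 0| := by
        refine intervalIntegral.norm_integral_le_of_norm_le_const fun t ht => ?_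
        have ht2 : |t| ≤ 2 := by
          rcases Set.mem_uIoc.1 ht with h | h
          · rw [abs_of_pos h.1]
            exact h.2.trans ((le_abs_self z).trans hz)
          · rw [abs_of_nonpos h.2]
            have := neg_abs_le z
            linarith [h.1]
        simpa using hPb 0 (Nat.zero_le _) t ht2
      rw [sub_zero] at h3
      refine h3.trans ?_
      have : 0 ≤ C * l := by positivity
      nlinarith
    | succ k =>
      rw [iteratedDeriv_succ', h2]
      refine (hPb k (by omega) z hz).trans ?_
      have : 0 ≤ C * l := by positivity
      nlinarith

/-- The profile of the trial functions across the strip: a compactly supported function whose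
derivative of order `m` is the concentrated profile `g(·/λ)`, up to `O(λ)`, and whose lower
derivatives are `O(λ)`. -/
theorem exists_profile {g : ℝ → ℝ} (hg : ContDiff ℝ ∞ g) (hgs : ∀ t, 2 ≤ |t| → g t = 0)
    (m : ℕ) (hm : m ≠ 0) : ∃ C : ℝ, 0 ≤ C ∧ ∀ l, 0 < l → l ≤ 1 / 2 → ∃ B : ℝ → ℝ, ContDiff ℝ ∞ B ∧
      (∀ k t, 2 < |t| → iteratedDeriv k B t = 0) ∧
      (∀ k < m, ∀ t, |iteratedDeriv k B t| ≤ C * l) ∧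
      ∀ t, |iteratedDeriv m B t - g (l⁻¹ * t)| ≤ C * l := by
  obtain ⟨m, rfl⟩ := Nat.exists_eq_succ_of_ne_zero hm
  have hgc : HasCompactSupport g := HasCompactSupport.intro (isCompact_closedBall (0 : ℝ) 2)
    fun t ht => hgs t (by
      rw [Metric.mem_closedBall, dist_zero_right, Real.norm_eq_abs, not_le] at ht
      exact ht.le)
  obtain ⟨C, hC, hP⟩ := exists_iterated_primitive hg hgc m
  obtain ⟨χ, hχ, hχs, -, -, hχ1, hχ0⟩ := exists_cutoff (a := 1) (b := 2) one_pos one_lt_two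
  obtain ⟨H, hH, hχH⟩ := exists_abs_iteratedDeriv_le hχ hχs (m + 1)
  refine ⟨2 ^ (m + 1) * H * C, by positivity, fun l hl hl2 => ?_⟩
  obtain ⟨P, hPc, hPg, hPb⟩ := hP l hl
  have hts : ∀ t, 2 < |t| → t ∉ tsupport (χ * P) := by
    intro t ht hmem
    have hsub : tsupport (χ * P) ⊆ Metric.closedBall 0 2 := by
      refine closure_minimal (fun z hz => ?_) Metric.isClosed_closedBall
      rw [Metric.mem_closedBall, dist_zero_right, Real.norm_eq_abs]
      by_contra! hc
      exact hz (by simp [hχ0 z hc.le])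
    have := hsub hmem
    rw [Metric.mem_closedBall, dist_zero_right, Real.norm_eq_abs] at this
    linarith
  have hout : ∀ k t, 2 < |t| → iteratedDeriv k (χ * P) t = 0 := fun k t ht =>
    iteratedDeriv_eq_zero_of_notMem_tsupport (hts t ht)
  have hle : ∀ {k : ℕ}, ((k : ℕ∞) : WithTop ℕ∞) ≤ ∞ := fun {k} => by exact_mod_cast le_top
  have hleib : ∀ k t, iteratedDeriv k (χ * P) t = ∑ i ∈ Finset.range (k + 1),
      (k.choose i : ℝ) * iteratedDeriv i χ t * iteratedDeriv (k - i) P t := fun k t =>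
    iteratedDeriv_mul (hχ.of_le hle).contDiffAt (hPc.of_le hle).contDiffAt
  have hsum : ∀ k ≤ m + 1, ∀ (s : Finset ℕ) t, |t| ≤ 2 → s ⊆ Finset.range (k + 1) →
      (∀ i ∈ s, k - i ≤ m) →
      |∑ i ∈ s, (k.choose i : ℝ) * iteratedDeriv i χ t * iteratedDeriv (k - i) P t|
        ≤ 2 ^ (m + 1) * H * C * l := by
    intro k hk s t ht hs hsm
    calc _ ≤ ∑ i ∈ s, (k.choose i : ℝ) * (H * (C * l)) := by
          refine (Finset.abs_sum_le_sum_abs _ _).trans (Finset.sum_le_sum fun i hi => ?_)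
          have hi' := Finset.mem_range.1 (hs hi)
          rw [abs_mul, abs_mul, Nat.abs_cast, mul_assoc]
          refine mul_le_mul_of_nonneg_left ?_ (Nat.cast_nonneg _)
          exact mul_le_mul (hχH i (by omega) t) (hPb _ (hsm i hi) t ht) (abs_nonneg _) hH
      _ ≤ ∑ i ∈ Finset.range (k + 1), (k.choose i : ℝ) * (H * (C * l)) :=
          Finset.sum_le_sum_of_subset_of_nonneg hs fun i _ _ => by positivity
      _ = 2 ^ k * (H * (C * l)) := by
          rw [← Finset.sum_mul]
          exact_mod_cast congrArg (fun n : ℕ => (n : ℝ) * (H * (C * l))) (Nat.sum_range_choose k)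
      _ ≤ 2 ^ (m + 1) * (H * (C * l)) := by
          refine mul_le_mul_of_nonneg_right ?_ (by positivity)
          exact pow_le_pow_right₀ one_le_two hk
      _ = _ := by ring
  have hBn : 0 ≤ 2 ^ (m + 1) * H * C * l := by positivity
  refine ⟨χ * P, hχ.mul hPc, hout, fun k hk t => ?_, fun t => ?_⟩
  · rcases le_or_gt |t| 2 with ht | ht
    · rw [hleib]
      exact hsum k hk.le _ t ht subset_rfl fun i _ => by omega
    · rw [hout k t ht, abs_zero]
      exact hBn
  · have hg0 : 1 ≤ |t| → g (l⁻¹ * t) = 0 := by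
      intro ht
      refine hgs _ ?_
      rw [abs_mul, abs_of_pos (inv_pos.2 hl), ← div_eq_inv_mul, le_div_iff₀ hl]
      linarith
    rcases le_or_gt |t| 2 with ht | ht
    · rw [Nat.succ_eq_add_one, hleib, Finset.sum_range_succ', Nat.choose_zero_right, Nat.cast_one,
        one_mul, iteratedDeriv_zero, Nat.sub_zero, hPg]
      have hχg : χ t * g (l⁻¹ * t) = g (l⁻¹ * t) := by
        rcases le_or_gt |t| 1 with h1 | h1
        · rw [hχ1 t h1, one_mul]
        · rw [hg0 h1.le, mul_zero]
      simp only [hχg, add_sub_cancel_right]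
      have h2 := hsum (m + 1) le_rfl ((Finset.range (m + 1)).image Nat.succ) t ht
        (by
          intro i hi
          obtain ⟨i', hi', rfl⟩ := Finset.mem_image.1 hi
          exact Finset.mem_range.2 (Nat.succ_lt_succ (Finset.mem_range.1 hi')))
        (by
          intro i hi
          obtain ⟨i', hi', rfl⟩ := Finset.mem_image.1 hi
          omega)
      rwa [Finset.sum_image fun a _ b _ h => Nat.succ_injective h] at h2
    · rw [hout _ t ht, hg0 (by linarith), sub_zero, abs_zero]
      exact hBn

/-! ### Trial functions -/

theorem volume_rectangle (s t : Set ℝ) :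
    volume {x : Plane | x 0 ∈ s ∧ x 1 ∈ t} = volume s * volume t := by
  have e : {x : Plane | x 0 ∈ s ∧ x 1 ∈ t} =
      (MeasurableEquiv.toLp 2 (Fin 2 → ℝ)).symm ⁻¹' (Set.univ.pi ![s, t]) := by
    ext x
    simp [Set.mem_pi, Fin.forall_fin_two]
  rw [e, (EuclideanSpace.volume_preserving_symm_measurableEquiv_toLp (Fin 2)).measure_preimage_equiv,
    volume_pi_pi]
  simp

theorem plane_norm_le (x : Plane) : ‖x‖ ≤ |x 0| + |x 1| := by
  rw [EuclideanSpace.norm_eq, Fin.sum_univ_two, Real.norm_eq_abs, Real.norm_eq_abs]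
  refine Real.sqrt_le_iff.2 ⟨by positivity, ?_⟩
  nlinarith [mul_nonneg (abs_nonneg (x 0)) (abs_nonneg (x 1))]

/-- The strip contains a rectangle of half-sides `ε` and `ε²`. -/
theorem mem_strip_of_abs_le {ε : ℝ} {x : Plane} (h0 : |x 0| ≤ ε) (h1 : |x 1| < ε ^ 2) :
    x ∈ strip 0 e₁ ε := by
  have hmem : (x 0) • e₁ ∈ segmentSet 0 e₁ ε :=
    ⟨x 0, (abs_le.1 h0).1, (abs_le.1 h0).2, by simp⟩
  refine (Metric.infDist_le_dist_of_mem hmem).trans_lt (lt_of_le_of_lt ?_ h1)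
  rw [dist_eq_norm]
  refine (plane_norm_le _).trans ?_
  simp [e₁]

/-- The strip is contained in a rectangle of half-sides `ε + ε²` and `ε²`. -/
theorem abs_lt_of_mem_strip {ε : ℝ} (hε : 0 < ε) {x : Plane} (hx : x ∈ strip 0 e₁ ε) :
    |x 0| < ε + ε ^ 2 ∧ |x 1| < ε ^ 2 := by
  obtain ⟨z, ⟨ρ, h1, h2, rfl⟩, hz⟩ := (Metric.infDist_lt_iff (segmentSet_nonempty 0 e₁ hε)).1 hx
  rw [dist_eq_norm] at hz
  have c0 := (PiLp.norm_apply_le (x - (0 + ρ • e₁)) 0).trans_lt hz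
  have c1 := (PiLp.norm_apply_le (x - (0 + ρ • e₁)) 1).trans_lt hz
  simp [e₁] at c0 c1
  refine ⟨?_, c1⟩
  rw [abs_lt] at c0 ⊢
  constructor <;> linarith [c0.1, c0.2]

theorem le_volume_real_strip {ε : ℝ} (hε : 0 < ε) :
    4 * ε ^ 3 ≤ volume.real (strip 0 e₁ ε) := by
  have h := volume_rectangle (Set.Icc (-ε) ε) (Set.Ioo (-ε ^ 2) (ε ^ 2))
  rw [Real.volume_Icc, Real.volume_Ioo, ← ENNReal.ofReal_mul (by linarith)] at h
  have hle := measureReal_mono (μ := volume) (s₁ := {x : Plane | x 0 ∈ Set.Icc (-ε) ε ∧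
    x 1 ∈ Set.Ioo (-ε ^ 2) (ε ^ 2)}) (fun x hx => mem_strip_of_abs_le (abs_le.2 hx.1)
      (abs_lt.2 hx.2)) (volume_strip_ne_top 0 e₁ hε)
  refine le_trans (le_of_eq ?_) hle
  rw [Measure.real, h, ENNReal.toReal_ofReal (mul_nonneg (by linarith) (by linarith [sq_nonneg ε]))]
  ring

/-- The support of the trial functions, a square of half-side `3ε`. -/
def trialBox (ε : ℝ) : Set Plane :=
  {x | x 0 ∈ Set.Icc (-(3 * ε)) (3 * ε) ∧ x 1 ∈ Set.Icc (-(3 * ε)) (3 * ε)}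

/-- The region outside the strip where `∂₂ᵐ` of the trial functions need not be small is contained
in this frame: the rectangle with half-sides `(1 + 2s)ε` and `(1 + 2s)ε²` without the rectangle of
half-sides `ε` and `ε²`. -/
def trialFrame (s ε : ℝ) : Set Plane :=
  {x | x 0 ∈ Set.Icc (-((1 + 2 * s) * ε)) ((1 + 2 * s) * ε) ∧
    x 1 ∈ Set.Icc (-((1 + 2 * s) * ε ^ 2)) ((1 + 2 * s) * ε ^ 2)} \
  {x | x 0 ∈ Set.Icc (-ε) ε ∧ x 1 ∈ Set.Ioo (-ε ^ 2) (ε ^ 2)}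

theorem measurableSet_rectangle {s t : Set ℝ} (hs : MeasurableSet s) (ht : MeasurableSet t) :
    MeasurableSet {x : Plane | x 0 ∈ s ∧ x 1 ∈ t} := by
  have h : ∀ c : Fin 2, Measurable (fun x : Plane => x c) := fun c =>
    (EuclideanSpace.proj (𝕜 := ℝ) c).continuous.measurable
  exact (h 0 hs).inter (h 1 ht)

theorem measurableSet_trialBox (ε : ℝ) : MeasurableSet (trialBox ε) :=
  measurableSet_rectangle measurableSet_Icc measurableSet_Icc

theorem measurableSet_trialFrame (s ε : ℝ) : MeasurableSet (trialFrame s ε) :=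
  (measurableSet_rectangle measurableSet_Icc measurableSet_Icc).diff
    (measurableSet_rectangle measurableSet_Icc measurableSet_Ioo)

theorem volume_trialBox {ε : ℝ} (hε : 0 < ε) :
    volume (trialBox ε) = ENNReal.ofReal (36 * ε ^ 2) := by
  rw [trialBox, volume_rectangle, Real.volume_Icc, ← ENNReal.ofReal_mul (by linarith)]
  congr 1
  ring

theorem volume_trialFrame {s ε : ℝ} (hs : 0 ≤ s) (hε : 0 < ε) :
    volume (trialFrame s ε) = ENNReal.ofReal (4 * ((1 + 2 * s) ^ 2 - 1) * ε ^ 3) := by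
  have h1 := volume_rectangle (Set.Icc (-((1 + 2 * s) * ε)) ((1 + 2 * s) * ε))
    (Set.Icc (-((1 + 2 * s) * ε ^ 2)) ((1 + 2 * s) * ε ^ 2))
  have h2 := volume_rectangle (Set.Icc (-ε) ε) (Set.Ioo (-ε ^ 2) (ε ^ 2))
  rw [Real.volume_Icc, Real.volume_Icc, ← ENNReal.ofReal_mul (by nlinarith)] at h1
  rw [Real.volume_Icc, Real.volume_Ioo, ← ENNReal.ofReal_mul (by linarith)] at h2
  rw [trialFrame, measure_sdiff _
    (measurableSet_rectangle measurableSet_Icc measurableSet_Ioo).nullMeasurableSet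
    (by rw [h2]; exact ENNReal.ofReal_ne_top), h1, h2,
    ← ENNReal.ofReal_sub _ (by nlinarith [pow_pos hε 3])]
  · congr 1
    ring
  · intro x hx
    have a1 : ε ≤ (1 + 2 * s) * ε := by nlinarith
    have a2 : ε ^ 2 ≤ (1 + 2 * s) * ε ^ 2 := by nlinarith [sq_nonneg ε]
    exact ⟨⟨by linarith [hx.1.1], by linarith [hx.1.2]⟩,
      ⟨by linarith [hx.2.1], by linarith [hx.2.2]⟩⟩

/-- The trial function `εᵐ A(x₁/ε) B(x₂/ε)` is built from a cut-off `A` along the strip and a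
profile `B` across it; the factor `εᵐ` makes its derivatives of order `m` scale invariant.  Up to an
error `O(ε)` inside a square of side `6ε`, they vanish, except that `∂₂ᵐ` is one in the strip and has
values in `[0, 1]` in a frame around it, whose area is `O(s ε³)`. -/
theorem exists_trial (m : ℕ) (hm : m ≠ 0) {s : ℝ} (hs : 0 < s) (hs1 : s ≤ 1 / 2) :
    ∃ C : ℝ, 0 ≤ C ∧ ∀ ε, 0 < ε → ε ≤ s → ∃ w : Plane → ℝ, ContDiff ℝ ∞ w ∧
      (∀ x, x ∉ trialBox ε → w x = 0) ∧ ∀ (j : MIdx m) (x : Plane),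
        (classicalPartial j w x
            - (strip 0 e₁ ε).indicator (fun _ => potentialCoeff (fun _ => 1) j) x) ^ 2
          ≤ (trialBox ε).indicator (fun _ => 2 * (C * ε) ^ 2) x
            + (trialFrame s ε).indicator (fun _ => 2) x := by
  obtain ⟨A, hA, hAs, hA0, hA1, hAone, hAzero⟩ := exists_cutoff (a := 1 + s) (b := 1 + 2 * s)
    (by linarith) (by linarith)
  obtain ⟨g, hg, -, hg0, hg1, hgone, hgzero⟩ := exists_cutoff (a := 1) (b := 1 + 2 * s)
    (by linarith) (by linarith)
  obtain ⟨H, hH, hAH⟩ := exists_abs_iteratedDeriv_le hA hAs m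
  obtain ⟨C, hC, hB⟩ := exists_profile hg (fun t ht => hgzero t (by linarith)) m hm
  refine ⟨(H + 1) * C, by positivity, fun ε hε hεs => ?_⟩
  obtain ⟨B, hBc, hBout, hBlow, hBtop⟩ := hB ε hε (hεs.trans hs1)
  have hεi : 0 < ε⁻¹ := inv_pos.2 hε
  have ha : ContDiff ℝ ∞ fun t => ε ^ m * A (ε⁻¹ * t) :=
    contDiff_const.mul (hA.comp (contDiff_const.mul contDiff_id))
  have hb : ContDiff ℝ ∞ fun t => B (ε⁻¹ * t) := hBc.comp (contDiff_const.mul contDiff_id)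
  have hle : ∀ {k : ℕ}, ((k : ℕ∞) : WithTop ℕ∞) ≤ ∞ := fun {k} => by exact_mod_cast le_top
  have habs : ∀ t, |ε⁻¹ * t| = |t| / ε := fun t => by
    rw [abs_mul, abs_of_pos hεi, ← div_eq_inv_mul]
  have hAout : ∀ k t, 3 < |t| → iteratedDeriv k A t = 0 := by
    intro k t ht
    refine iteratedDeriv_eq_zero_of_notMem_tsupport fun hmem => ?_
    have hsub : tsupport A ⊆ Metric.closedBall 0 3 := by
      refine closure_minimal (fun z hz => ?_) Metric.isClosed_closedBall
      rw [Metric.mem_closedBall, dist_zero_right, Real.norm_eq_abs]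
      by_contra! hc
      exact hz (hAzero z (by linarith))
    have := hsub hmem
    rw [Metric.mem_closedBall, dist_zero_right, Real.norm_eq_abs] at this
    linarith
  have hbox : ∀ x : Plane, x ∉ trialBox ε → 3 < |ε⁻¹ * x 0| ∨ 3 < |ε⁻¹ * x 1| := by
    intro x hx
    by_contra! hc
    rw [habs, habs, div_le_iff₀ hε, div_le_iff₀ hε] at hc
    exact hx ⟨abs_le.1 hc.1, abs_le.1 hc.2⟩
  refine ⟨fun x => ε ^ m * A (ε⁻¹ * x 0) * B (ε⁻¹ * x 1), contDiff_coord_mul ha hb,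
    fun x hx => ?_, fun j x => ?_⟩
  · rcases hbox x hx with h | h
    · have := hAout 0 _ h
      rw [iteratedDeriv_zero] at this
      simp [this]
    · have := hBout 0 _ (lt_trans (by norm_num) h)
      rw [iteratedDeriv_zero] at this
      simp [this]
  have hj := idxCount_zero_add_one j
  have hder : classicalPartial j (fun x : Plane => ε ^ m * A (ε⁻¹ * x 0) * B (ε⁻¹ * x 1)) x =
      iteratedDeriv (idxCount 0 j) A (ε⁻¹ * x 0) * iteratedDeriv (idxCount 1 j) B (ε⁻¹ * x 1) := by
    rw [classicalPartial_coord_mul (a := fun t => ε ^ m * A (ε⁻¹ * t))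
      (b := fun t => B (ε⁻¹ * t)) j ha hb]
    simp only
    rw [iteratedDeriv_const_mul_field, iteratedDeriv_comp_const_mul (hA.of_le hle),
      iteratedDeriv_comp_const_mul (hBc.of_le hle)]
    nth_rewrite 1 [← hj]
    rw [pow_add, inv_pow, inv_pow]
    have := hε.ne'
    field_simp
  rw [hder]
  have hzero : x ∉ trialBox ε → iteratedDeriv (idxCount 0 j) A (ε⁻¹ * x 0) *
      iteratedDeriv (idxCount 1 j) B (ε⁻¹ * x 1) = 0 := by
    intro hx
    rcases hbox x hx with h | h
    · rw [hAout _ _ h, zero_mul]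
    · rw [hBout _ _ (lt_trans (by norm_num) h), mul_zero]
  have hstrip : x ∈ strip 0 e₁ ε → x ∈ trialBox ε ∧ A (ε⁻¹ * x 0) = 1 ∧
      g (ε⁻¹ * (ε⁻¹ * x 1)) = 1 := by
    intro hx
    obtain ⟨h0, h1⟩ := abs_lt_of_mem_strip hε hx
    have b0 : |x 0| ≤ 3 * ε := by nlinarith
    have b1 : |x 1| ≤ 3 * ε := by nlinarith
    refine ⟨⟨abs_le.1 b0, abs_le.1 b1⟩, hAone _ ?_, hgone _ ?_⟩
    · rw [habs, div_le_iff₀ hε]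
      nlinarith
    · rw [abs_mul, habs, abs_of_pos hεi, ← div_eq_inv_mul, div_div, div_le_one (by positivity)]
      nlinarith
  have hfr0 : 0 ≤ (trialFrame s ε).indicator (fun _ => (2 : ℝ)) x :=
    Set.indicator_nonneg (fun _ _ => zero_le_two) x
  by_cases hxb : x ∈ trialBox ε
  swap
  · rw [hzero hxb, Set.indicator_of_notMem fun h => hxb (hstrip h).1, Set.indicator_of_notMem hxb]
    simpa using hfr0
  rw [Set.indicator_of_mem hxb, potentialCoeff_const_one]
  by_cases hj1 : j = fun _ => 1
  · have h0 : idxCount 0 j = 0 := by simp [hj1, idxCount]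
    have h1 : idxCount 1 j = m := by omega
    rw [if_pos hj1, h0, h1, iteratedDeriv_zero]
    set α := A (ε⁻¹ * x 0) with hα
    set β := iteratedDeriv m B (ε⁻¹ * x 1) with hβ
    set G := g (ε⁻¹ * (ε⁻¹ * x 1)) with hG
    have hβG : |β - G| ≤ C * ε := hBtop _
    have hα0 : 0 ≤ α := hA0 _
    have hα1 : α ≤ 1 := hA1 _
    have hG0 : 0 ≤ G := hg0 _
    have hG1 : G ≤ 1 := hg1 _
    have hmain : (α * G - (strip 0 e₁ ε).indicator (fun _ => (1 : ℝ)) x) ^ 2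
        ≤ (trialFrame s ε).indicator (fun _ => 1) x := by
      by_cases hxS : x ∈ strip 0 e₁ ε
      · obtain ⟨-, e1, e2⟩ := hstrip hxS
        rw [Set.indicator_of_mem hxS, e1, e2]
        simpa using Set.indicator_nonneg (fun _ _ => zero_le_one) x
      · rw [Set.indicator_of_notMem hxS, sub_zero]
        by_cases hxF : x ∈ trialFrame s ε
        · rw [Set.indicator_of_mem hxF]
          have : α * G ≤ 1 := mul_le_one₀ hα1 hG0 hG1
          nlinarith [mul_nonneg hα0 hG0]
        · rw [Set.indicator_of_notMem hxF]
          have : α * G = 0 := by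
            by_contra hne
            refine hxF ⟨⟨abs_le.1 ?_, abs_le.1 ?_⟩, fun h => hxS
              (mem_strip_of_abs_le (abs_le.2 h.1) (abs_lt.2 h.2))⟩
            · by_contra! hc
              refine hne ?_
              rw [hα, hAzero _ ?_, zero_mul]
              rw [habs, le_div_iff₀ hε]
              exact hc.le
            · by_contra! hc
              refine hne ?_
              rw [hG, hgzero _ ?_, mul_zero]
              rw [abs_mul, habs, abs_of_pos hεi, ← div_eq_inv_mul, div_div,
                le_div_iff₀ (by positivity), ← sq]
              exact hc.le
          rw [this]
          norm_num
    have hsq : (α * (β - G)) ^ 2 ≤ ((H + 1) * C * ε) ^ 2 := by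
      refine sq_le_sq.2 ?_
      have hCε : 0 ≤ C * ε := by positivity
      rw [abs_mul, abs_of_nonneg hα0, abs_of_nonneg (by positivity : 0 ≤ (H + 1) * C * ε)]
      calc α * |β - G| ≤ 1 * (C * ε) := mul_le_mul hα1 hβG (abs_nonneg _) zero_le_one
        _ ≤ (H + 1) * C * ε := by nlinarith
    have h2 : (trialFrame s ε).indicator (fun _ => (2 : ℝ)) x
        = 2 * (trialFrame s ε).indicator (fun _ => 1) x := by
      by_cases hxF : x ∈ trialFrame s ε <;> simp [hxF]
    rw [h2]
    set I := (strip 0 e₁ ε).indicator (fun _ => (1 : ℝ)) x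
    have hsplit : α * β - I = α * (β - G) + (α * G - I) := by ring
    rw [hsplit]
    nlinarith [sq_nonneg (α * (β - G) - (α * G - I))]
  · have h1 : idxCount 1 j < m := by
      have h0 : idxCount 0 j ≠ 0 := by
        intro h0
        have hpc := potentialCoeff_const_one j
        rw [if_neg hj1, potentialCoeff] at hpc
        have e0 : idxCount 0 (fun _ : Fin m => (1 : Fin 2)) = 0 := by simp [idxCount]
        have e1 : idxCount 1 (fun _ : Fin m => (1 : Fin 2)) = m := by simp [idxCount]
        rw [e0, e1, if_pos h0] at hpc
        have : (m.factorial : ℝ) ≠ 0 := by positivity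
        simp [this] at hpc
      omega
    rw [if_neg hj1]
    have hI : (strip 0 e₁ ε).indicator (fun _ => (0 : ℝ)) x = 0 := by simp
    rw [hI, sub_zero]
    have hA' := hAH (idxCount 0 j) (by omega) (ε⁻¹ * x 0)
    have hB' := hBlow _ h1 (ε⁻¹ * x 1)
    have hsq : (iteratedDeriv (idxCount 0 j) A (ε⁻¹ * x 0) *
        iteratedDeriv (idxCount 1 j) B (ε⁻¹ * x 1)) ^ 2 ≤ ((H + 1) * C * ε) ^ 2 := by
      refine sq_le_sq.2 ?_
      rw [abs_mul, abs_of_nonneg (by positivity : 0 ≤ (H + 1) * C * ε)]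
      calc _ ≤ H * (C * ε) := mul_le_mul hA' hB' (abs_nonneg _) hH
        _ ≤ (H + 1) * C * ε := by nlinarith [mul_nonneg hC hε.le]
    nlinarith [sq_nonneg ((H + 1) * C * ε)]

theorem trialBox_subset_closedBall (ε : ℝ) : trialBox ε ⊆ Metric.closedBall 0 (6 * ε) := by
  intro x hx
  rw [Metric.mem_closedBall, dist_zero_right]
  have h0 := abs_le.2 hx.1
  have h1 := abs_le.2 hx.2
  linarith [plane_norm_le x]

/-- Test functions approximate the deviation `(γ⁻¹ - 1) ∇ᵐVⁱ`, for `Vⁱ = x₂ᵐ / m!`, up to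
`o(|Ω_ε|^{1/2})` in `L²`. -/
theorem eventually_exists_trial {Ω : Set Plane} (hΩ : IsOpen Ω) (h0 : (0 : Plane) ∈ Ω)
    {m : ℕ} (hm : m ≠ 0) (κ : ℝ) {ε : ℕ → ℝ} (hε : ∀ n, 0 < ε n) (hε0 : Tendsto ε atTop (𝓝 0)) {η : ℝ} (hη : 0 < η) :
    ∀ᶠ n in atTop, ∃ ψ, IsTest Ω ψ ∧
      ∑ j : MIdx m, ∫ x in Ω, (classicalPartial j ψ x
        - ((gammaCoeff κ 0 e₁ (ε n) x)⁻¹ - 1) * potentialCoeff (fun _ => 1) j) ^ 2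
        ≤ η * volume.real (strip 0 e₁ (ε n)) := by
  set c : ℝ := κ⁻¹ - 1 with hc
  set N : ℝ := ((Fintype.card (MIdx m) : ℕ) : ℝ) with hN
  have hN0 : 0 ≤ c ^ 2 * N := by positivity
  -- `s` makes the contribution of the frame small, and then `ε` that of the square
  set s : ℝ := min (1 / 2) (η / (24 * (c ^ 2 * N + 1))) with hs
  have hs0 : 0 < s := lt_min (by norm_num) (by positivity)
  have hs1 : s ≤ 1 / 2 := min_le_left _ _
  have hs2 : 24 * (c ^ 2 * N) * s ≤ η := by
    have h := min_le_right (1 / 2) (η / (24 * (c ^ 2 * N + 1)))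
    rw [← hs, le_div_iff₀ (by positivity)] at h
    nlinarith
  obtain ⟨C, hC, hw⟩ := exists_trial m hm hs0 hs1
  obtain ⟨r, hr, hrΩ⟩ := Metric.nhds_basis_closedBall.mem_iff.1 (hΩ.mem_nhds h0)
  have e1 := hε0.eventually_le_const hs0
  have e2 := hε0.eventually_le_const (show 0 < η / (36 * (c ^ 2 * N * C ^ 2 + 1)) by positivity)
  have e3 := hε0.eventually_le_const (show 0 < r / 6 by positivity)
  filter_upwards [e1, e2, e3] with n h1 h2 h3
  have hp := hε n
  set δ := ε n with hδ
  obtain ⟨w, hwc, hwout, hwb⟩ := hw δ hp h1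
  have hboxΩ : trialBox δ ⊆ Metric.closedBall 0 r :=
    (trialBox_subset_closedBall δ).trans (Metric.closedBall_subset_closedBall (by linarith))
  have hboxc : IsClosed (trialBox δ) := by
    have h : ∀ c : Fin 2, Continuous (fun x : Plane => x c) := fun c =>
      (EuclideanSpace.proj (𝕜 := ℝ) c).continuous
    exact (isClosed_Icc.preimage (h 0)).inter (isClosed_Icc.preimage (h 1))
  have hts : tsupport w ⊆ trialBox δ := closure_minimal (fun x hx => by
    by_contra hxb
    exact hx (hwout x hxb)) hboxc
  have hwt : IsTest Ω w := ⟨hwc, (isCompact_closedBall (0 : Plane) r).of_isClosed_subset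
    (isClosed_tsupport w) (hts.trans hboxΩ), hts.trans (hboxΩ.trans hrΩ)⟩
  refine ⟨c • w, hwt.const_smul c, ?_⟩
  have hmb := measurableSet_trialBox δ
  have hmf := measurableSet_trialFrame s δ
  have hvb := volume_trialBox hp
  have hvf := volume_trialFrame hs0.le hp
  have hfb : volume (trialBox δ) ≠ ⊤ := by rw [hvb]; exact ENNReal.ofReal_ne_top
  have hff : volume (trialFrame s δ) ≠ ⊤ := by rw [hvf]; exact ENNReal.ofReal_ne_top
  have hib : Integrable ((trialBox δ).indicator fun _ => 2 * (C * δ) ^ 2) (volume.restrict Ω) :=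
    ((integrable_indicator_iff hmb).2 (integrableOn_const hfb)).restrict
  have hif : Integrable ((trialFrame s δ).indicator fun _ => (2 : ℝ)) (volume.restrict Ω) :=
    ((integrable_indicator_iff hmf).2 (integrableOn_const hff)).restrict
  have hterm : ∀ j : MIdx m, ∫ x in Ω, (classicalPartial j (c • w) x
        - ((gammaCoeff κ 0 e₁ δ x)⁻¹ - 1) * potentialCoeff (fun _ => 1) j) ^ 2
      ≤ c ^ 2 * (72 * C ^ 2 * δ ^ 4 + 48 * s * δ ^ 3) := by
    intro j
    have hpt : ∀ x, (classicalPartial j (c • w) x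
        - ((gammaCoeff κ 0 e₁ δ x)⁻¹ - 1) * potentialCoeff (fun _ => 1) j) ^ 2
        ≤ c ^ 2 * ((trialBox δ).indicator (fun _ => 2 * (C * δ) ^ 2) x
          + (trialFrame s δ).indicator (fun _ => 2) x) := by
      intro x
      have e : classicalPartial j (c • w) x
          - ((gammaCoeff κ 0 e₁ δ x)⁻¹ - 1) * potentialCoeff (fun _ => 1) j
          = c * (classicalPartial j w x
            - (strip 0 e₁ δ).indicator (fun _ => potentialCoeff (fun _ => 1) j) x) := by
        rw [classicalPartial_const_smul j c hwc]
        by_cases hx : x ∈ strip 0 e₁ δ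
        · rw [Set.indicator_of_mem hx, gammaCoeff_of_mem hx, ← hc, Pi.smul_apply, smul_eq_mul]
          ring
        · rw [Set.indicator_of_notMem hx, gammaCoeff_of_notMem hx, Pi.smul_apply, smul_eq_mul]
          simp
      rw [e, mul_pow]
      exact mul_le_mul_of_nonneg_left (hwb j x) (sq_nonneg c)
    have hint := integral_mono_of_nonneg (μ := volume.restrict Ω)
      (Eventually.of_forall fun x => sq_nonneg _) ((hib.add hif).const_mul (c ^ 2))
      (Eventually.of_forall hpt)
    refine hint.trans ?_
    rw [integral_const_mul]
    refine mul_le_mul_of_nonneg_left ?_ (sq_nonneg c)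
    have hadd := integral_add hib hif
    simp only [Pi.add_apply] at hadd ⊢
    rw [hadd]
    have b1 := setIntegral_indicator_const_le (Ω := Ω) hmb hfb
      (show 0 ≤ 2 * (C * δ) ^ 2 by positivity)
    have b2 := setIntegral_indicator_const_le (Ω := Ω) hmf hff zero_le_two
    have hfn : 0 ≤ 4 * ((1 + 2 * s) ^ 2 - 1) * δ ^ 3 := by
      have : 0 ≤ (1 + 2 * s) ^ 2 - 1 := by nlinarith
      positivity
    rw [Measure.real, hvb, ENNReal.toReal_ofReal (by positivity)] at b1
    rw [Measure.real, hvf, ENNReal.toReal_ofReal hfn] at b2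
    have hd3 : 0 < δ ^ 3 := by positivity
    have b3 : 2 * (4 * ((1 + 2 * s) ^ 2 - 1) * δ ^ 3) ≤ 48 * s * δ ^ 3 := by
      have : 2 * (4 * ((1 + 2 * s) ^ 2 - 1)) ≤ 48 * s := by nlinarith
      nlinarith
    have b4 : 2 * (C * δ) ^ 2 * (36 * δ ^ 2) = 72 * C ^ 2 * δ ^ 4 := by ring
    linarith
  have hS := le_volume_real_strip hp
  have h2' : 36 * (c ^ 2 * N * C ^ 2) * δ ≤ η := by
    rw [le_div_iff₀ (by positivity)] at h2
    nlinarith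
  calc _ ≤ ∑ _j : MIdx m, c ^ 2 * (72 * C ^ 2 * δ ^ 4 + 48 * s * δ ^ 3) :=
        Finset.sum_le_sum fun j _ => hterm j
    _ = (2 * (36 * (c ^ 2 * N * C ^ 2) * δ) + 2 * (24 * (c ^ 2 * N) * s)) * δ ^ 3 := by
        rw [Finset.sum_const, Finset.card_univ, nsmul_eq_mul, ← hN]
        ring
    _ ≤ (2 * η + 2 * η) * δ ^ 3 := by
        refine mul_le_mul_of_nonneg_right ?_ (by positivity)
        linarith
    _ = η * (4 * δ ^ 3) := by ring
    _ ≤ η * volume.real (strip 0 e₁ δ) := mul_le_mul_of_nonneg_left hS hη.le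

theorem proposition4p4 (m : ℕ) (hm : 2 ≤ m) (κ : ℝ) (hκ₀ : 0 < κ) (hκ₁ : κ < 1 / 2)
    (Ω : Set Plane) (hΩo : IsOpen Ω) (hΩb : Bornology.IsBounded Ω) (h0 : (0 : Plane) ∈ Ω) :
    (∀ ε : ℕ → ℝ, (∀ n, 0 < ε n) → Tendsto ε atTop (𝓝 0) →
      ∃ s : ℕ → ℕ, StrictMono s ∧
        ∃ M : Tensor2 m, IsPolarizationTensor Ω κ 0 e₁ (fun n => ε (s n)) M) ∧
    (∀ (ε : ℕ → ℝ) (M : Tensor2 m), (∀ n, 0 < ε n) → Tendsto ε atTop (𝓝 0) →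
      IsPolarizationTensor Ω κ 0 e₁ ε M →
        (M *ᵥ tensorPower m e₂) ⬝ᵥ tensorPower m e₂ = 1 / κ) := by
  have hm0 : m ≠ 0 := by omega
  have hκ : κ ≤ 1 := by linarith
  refine ⟨fun ε hε hε0 => ?_, fun ε M hε hε0 hM => ?_⟩
  · choose V hV using fun n i =>
      exists_isPerturbedPotential hΩo hΩb (m := m) hκ₀ hκ 0 e₁ (ε n) i
    exact exists_subseq_isPolarizationTensor hΩo hΩb hm0 hκ₀ hκ h0 hε hε0 hV
  · rw [dotProduct_mulVec_tensorPower_e₂, hM.eq_of_trial hΩo hΩb hm0 hκ₀ hκ h0 hε hε0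
      (fun η hη => eventually_exists_trial hΩo h0 hm0 κ hε hε0 hη),
      potentialCoeff_const_one, if_pos rfl, mul_one, one_div]
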